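/- Let $\mathbb Z_+=\{0,1,2,\dots\}$ and $\mathbb Z_+^*=\mathbb Z_+\cup\{\infty\}$ its one-point compactification. Let $(S,<)$ be a linearly ordered set isomorphic to $(\mathbb Z_+,<)$, with the discrete topology and with least element $e$ (the identity of the semigroup $(S,\max)$); write $S=\mathbb Z_+$, $e=0$ under the isomorphism, and $\mathcal L_n=\{k: k<n\}$. For each $n\neq 0$ let $q_n$ be a probability measure on $S$ with support $Q_n$, such that (ii) $\mathcal L_n\subset Q_n\subset\mathcal L_n\cup\{n\}$ for all $n\neq 0$; (iii) for all $0\neq m<n$: $q_n(0)=q_n(m)\,q_m(0)$ and $q_n(0)\bigl(1+\sum_{0\neq k<n}\frac1{q_k(0)}\bigr)\le 1$. Define $\delta_m*\delta_n=\delta_{\max\{m,n\}}$ if $m\ne n$ or $m=n=0$, and $\delta_n*\delta_n=q_n$ for $n\neq 0$. With this convolution, identity $e$ and the identity map as involution, $(S,*)$ is a hermitian discrete hypergroup; its Haar measure, normalised by $\lambda(0)=1$, is $\lambda(n)=1/(\delta_n*\delta_n)(0)$. For a hypergroup $K$ with involution $x\mapsto\check x$, let $\mathcal X_b(K)$ be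 the set of bounded continuous functions $\chi:K\to\mathbb C$, $\chi\ne0$, with $\int_K\chi\,d(\delta_x*\delta_y)=\chi(x)\chi(y)$ for all $x,y\in K$, and let $\widehat K$ be the set of those $\chi\in\mathcal X_b(K)$ with $\chi(\check x)=\overline{\chi(x)}$ for all $x$, with the topology of uniform convergence on compact sets. To say that $\widehat K$ is a hypergroup under pointwise multiplication means that it is a hypergroup with $\int_{\widehat K}\tau(x)\,d(\delta_\chi*\delta_\psi)(\tau)=\chi(x)\psi(x)$ for all $\chi,\psi\in\widehat K$ and $x\in K$, with the constant function $1$ as identity and with complex conjugation as involution. Put $\beta_k=-\lambda(\mathcal L_{k+1})/\lambda(k+1)$ for $k\in\mathbb Z_+$. Let $\chi_\infty\equiv1$ on $S$ and, for $k\in\mathbb Z_+$, let $\chi_k(n)=1$ for $n\le k$, $\chi_k(k+1)=\beta_k$, and $\chi_k(n)=0$ for $n>k+1$; the map $k\mapsto\chi_k$ is a homeomorphism of $\mathbb Z_+^*$ onto $\widehat S$. **Theorem.** The space $\widehat S$ is countable and compact, and it is a hermitian hypergroup under pointwise multiplication. Its convolution is given by $$\delta_{\chi_m}*\delta_{\chi_n}=\delta_{\chi_{\min\{m,n\}}}\quad\text{for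 } m,n\in\mathbb Z_+^* \text{ with } m\neq n \text{ or } m=n=\infty,$$ $$\delta_{\chi_m}*\delta_{\chi_m}=\sum_{j\in\mathbb Z_+}\gamma_j^m\,\delta_{\chi_j}\quad\text{for } m\in\mathbb Z_+,$$ where $\gamma_j^m=0$ for $j<m$, $\gamma_m^m=1+\beta_m\ge0$, and, for $p\ge1$, $$\gamma_{m+p}^m=\prod_{j=m}^{m+p-1}\frac{-\beta_j}{1-\beta_{j+1}}>0.$$ Moreover $\mathcal X_b(\widehat S)=\widehat{\widehat S}$. The space $\widehat{\widehat S}$ is again a hermitian hypergroup under pointwise multiplication, and $n\mapsto\xi_n$, $\xi_n(\chi)=\chi(n)$, is a homeomorphism $S\to\widehat{\widehat S}$ and an isomorphism of hypergroups $(S,*)\cong\widehat{\widehat S}$. -/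

import Mathlib

open MeasureTheory
open scoped ENNReal

noncomputable section

/-- The data of a convolution on `K`: the probability measures `δ_x * δ_y`, a distinguished
element and a map `K → K` (the candidates for identity and involution).  The laws are stated
in `IsHypergroup`. -/
structure ConvolutionData (K : Type*) [MeasurableSpace K] where
  /-- `conv x y` is the measure `δ_x * δ_y`. -/
  conv : K → K → ProbabilityMeasure K
  /-- the identity -/
  e : K
  /-- the involution -/
  inv : K → K

/-- `(K, *, ∨)` is a (locally compact Hausdorff) hypergroup.  For discrete `K` the topological
conditions are void, compact support means finite support, and these are exactly the axioms of
a discrete hypergroup. -/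
structure IsHypergroup {K : Type*} [TopologicalSpace K] [MeasurableSpace K] [BorelSpace K]
    (H : ConvolutionData K) : Prop where
  t2 : T2Space K
  locallyCompact : LocallyCompactSpace K
  regular : ∀ x y, (H.conv x y : Measure K).Regular
  isCompact_support : ∀ x y, IsCompact (H.conv x y : Measure K).support
  /-- `(x, y) ↦ δ_x * δ_y` is continuous for the weak topology on probability measures. -/
  continuous_conv : Continuous fun p : K × K => H.conv p.1 p.2
  /-- `(x, y) ↦ spt (δ_x * δ_y)` is continuous for the Michael (Vietoris) topology. -/
  continuous_support :
    @Continuous (K × K) (Set K) _ (TopologicalSpace.vietoris K)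
      fun p => (H.conv p.1 p.2 : Measure K).support
  /-- `(δ_x * δ_y) * δ_z = δ_x * (δ_y * δ_z)`, tested against bounded continuous functions; here
  `∫ f d(μ * ν) = ∫ ∫ (∫ f d(δ_s * δ_t)) dμ(s) dν(t)`. -/
  assoc : ∀ (x y z : K) (f : BoundedContinuousFunction K ℝ),
    ∫ t, (∫ w, f w ∂(H.conv t z : Measure K)) ∂(H.conv x y : Measure K) =
      ∫ t, (∫ w, f w ∂(H.conv x t : Measure K)) ∂(H.conv y z : Measure K)
  conv_e : ∀ x, (H.conv x H.e : Measure K) = Measure.dirac x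
  e_conv : ∀ x, (H.conv H.e x : Measure K) = Measure.dirac x
  inv_inv : ∀ x, H.inv (H.inv x) = x
  continuous_inv : Continuous H.inv
  /-- `(δ_x * δ_y)ˇ = δ_yˇ * δ_xˇ` -/
  map_inv : ∀ x y,
    (H.conv x y : Measure K).map H.inv = (H.conv (H.inv y) (H.inv x) : Measure K)
  e_mem_support : ∀ x y, H.e ∈ (H.conv x (H.inv y) : Measure K).support ↔ x = y

/-- The involution is the identity map. -/
def IsHermitian {K : Type*} [MeasurableSpace K] (H : ConvolutionData K) : Prop :=
  ∀ x, H.inv x = x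

/-- `χ ∈ 𝒳_b(K)`: a bounded continuous nonzero function with `χ(x * y) = χ(x) χ(y)`. -/
def IsBddCharacter {K : Type*} [TopologicalSpace K] [MeasurableSpace K]
    (H : ConvolutionData K) (χ : C(K, ℂ)) : Prop :=
  (∃ C : ℝ, ∀ x, ‖χ x‖ ≤ C) ∧ χ ≠ 0 ∧
    ∀ x y, ∫ z, χ z ∂(H.conv x y : Measure K) = χ x * χ y

/-- A character with `χ(xˇ) = conj (χ(x))`. -/
def IsSymmCharacter {K : Type*} [TopologicalSpace K] [MeasurableSpace K]
    (H : ConvolutionData K) (χ : C(K, ℂ)) : Prop :=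
  IsBddCharacter H χ ∧ ∀ x, χ (H.inv x) = (starRingEnd ℂ) (χ x)

/-- The dual `K̂`: the space of symmetric characters. -/
def SymmDual {K : Type*} [TopologicalSpace K] [MeasurableSpace K]
    (H : ConvolutionData K) : Type _ :=
  {χ : C(K, ℂ) // IsSymmCharacter H χ}

namespace SymmDual

variable {K : Type*} [TopologicalSpace K] [MeasurableSpace K] {H : ConvolutionData K}

instance : CoeFun (SymmDual H) (fun _ => K → ℂ) := ⟨fun χ => χ.1⟩

/-- The topology of uniform convergence on compact sets (Mathlib's compact-open topology). -/
instance : TopologicalSpace (SymmDual H) :=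
  inferInstanceAs (TopologicalSpace {χ : C(K, ℂ) // IsSymmCharacter H χ})

instance : MeasurableSpace (SymmDual H) := borel _

instance : BorelSpace (SymmDual H) := ⟨rfl⟩

end SymmDual

/-- `D` is the convolution structure on `K̂` given by pointwise multiplication:
`χ(x) ψ(x) = ∫ τ(x) d(δ_χ * δ_ψ)(τ)`, the identity is the constant character `1` and the
involution is complex conjugation. -/
structure IsPointwiseMul {K : Type*} [TopologicalSpace K] [MeasurableSpace K]
    {H : ConvolutionData K} (D : ConvolutionData (SymmDual H)) : Prop where
  integral_conv : ∀ (χ ψ : SymmDual H) (x : K),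
    ∫ τ : SymmDual H, τ x ∂(D.conv χ ψ : Measure (SymmDual H)) = χ x * ψ x
  e_apply : ∀ x, D.e x = 1
  inv_apply : ∀ (χ : SymmDual H) (x : K), D.inv χ x = (starRingEnd ℂ) (χ x)

/-- A homeomorphism which is an isomorphism of convolution structures. -/
structure IsHypergroupIso {K L : Type*} [TopologicalSpace K] [MeasurableSpace K]
    [TopologicalSpace L] [MeasurableSpace L] (H : ConvolutionData K) (H' : ConvolutionData L)
    (f : K ≃ₜ L) : Prop where
  map_conv : ∀ x y, (H.conv x y : Measure K).map f = (H'.conv (f x) (f y) : Measure L)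
  map_e : f H.e = H'.e
  map_inv : ∀ x, f (H.inv x) = H'.inv (f x)

/-- The mass at `n` of the Haar measure of a discrete hypergroup, normalised at the identity:
`λ(n) = 1 / (δ_ň * δ_n)(e)`. -/
def haarWeight {K : Type*} [MeasurableSpace K] (H : ConvolutionData K) (n : K) : ℝ :=
  ((H.conv (H.inv n) n : Measure K) {H.e}).toReal⁻¹

section MaxSemigroup

variable {S : Type*} [LinearOrder S] [OrderBot S]

/-- The deformation of the "max" semigroup `S` along the diagonal by the probability measures
`q n`: `δ_m * δ_n = δ_{max(m,n)}` if `m ≠ n` or `m = n = e`, and `δ_n * δ_n = q n` if `n ≠ e`,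
where the identity `e` of `S` is its least element; the involution is the identity map.  The
value `q ⊥` is not used. -/
def maxDeformation [MeasurableSpace S] (q : S → PMF S) : ConvolutionData S where
  conv m n :=
    ⟨(if m = n ∧ n ≠ ⊥ then q n else PMF.pure (max m n)).toMeasure, inferInstance⟩
  e := ⊥
  inv := id

/-- The conditions on the measures `q n`, `n ≠ e`, where `Q_n` denotes the support of `q n` and
`L_n = {k | k < n}`. -/
structure IsAdmissible (q : S → PMF S) : Prop where
  lower_subset : ∀ n, n ≠ ⊥ → Set.Iio n ⊆ (q n).support
  subset_lower : ∀ n, n ≠ ⊥ → (q n).support ⊆ Set.Iic n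
  apply_bot : ∀ m n, m ≠ ⊥ → m < n → q n ⊥ = q n m * q m ⊥
  sum_le : ∀ m n, m ≠ ⊥ → m < n →
    q n ⊥ * (1 + ∑' k : {k : S // k ≠ ⊥ ∧ k < n}, (q k ⊥)⁻¹) ≤ 1

/-- `β_k = - λ(L_{k+1}) / λ(k+1)`, where `S` is indexed by `ℤ₊` through `φ`. -/
def betaCoeff [MeasurableSpace S] (q : S → PMF S) (φ : ℕ ≃o S) (k : ℕ) : ℝ :=
  -(∑ j ∈ Finset.range (k + 1), haarWeight (maxDeformation q) (φ j)) /
    haarWeight (maxDeformation q) (φ (k + 1))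

end MaxSemigroup

/-- The table of characters: `χ_∞ = 1` and, for finite `k`, `χ_k(n)` is `1` for `n ≤ k`, `β_k`
for `n = k + 1`, and `0` for `n > k + 1`. -/
def charTable (β : ℕ → ℝ) (k : ℕ∞) (n : ℕ) : ℝ :=
  if (n : ℕ∞) ≤ k then 1 else if (n : ℕ∞) = k + 1 then β k.toNat else 0

/-- The coefficients `γ_j^m`. -/
def gammaCoeff (β : ℕ → ℝ) (m j : ℕ) : ℝ :=
  if j < m then 0
  else if j = m then 1 + β m
  else ∏ i ∈ Finset.Ico m j, (-β i) / (1 - β (i + 1))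

end

/-! Write $a_n=\lambda(n)$ and $A_n=a_0+\dots+a_{n-1}$. The equation in (iii) says $q_n(j)=a_j/a_n$
for $j<n$, so $A_n\le a_n$ (`IsAdmissible.isSuperincreasing`) and
$\beta_k=-A_{k+1}/a_{k+1}\in[-1,0)$. From there on only the sequence $a$ matters.

Both sides of the duality are read off the matrix `charTable`: row $k$ is $\chi_k$, column $n$ is
$\xi_n$. A finite row consists of ones, one $\beta$, then zeros; a column $n\ge1$ of zeros, one
$\beta$, then ones. Off the diagonal, products therefore collapse to the larger column or the
smaller row. Conversely, off-diagonal multiplicativity forces a nonconstant character into this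
shape up to one value, and the diagonal relation there is a quadratic with roots $1$ and $\beta$
(`IsAdmissible.exists_eq_charTable_row`, `IsSuperincreasing.exists_eq_charTable_column`).

The coefficients telescope: $\gamma^m_j=C_m(1/A_{j+1}-1/A_{j+2})$ for $j>m$, with
$C_m=A_{m+1}A_{m+2}/a_{m+1}$. As $A_n\to\infty$ the total mass is $1$, and the ratio of consecutive
tails is the one that makes the columns multiplicative (`integral_charTable_dualConv`).

Associativity on either side holds because rows and columns separate probability measures
(`ConvolutionData.assoc_of_separating`). The structures are built on $\mathbb Z_+^*$ and on $S$,
then carried to the dual and the second dual along homeomorphisms. -/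

noncomputable section

/-! ### Transport of hypergroups along homeomorphisms. -/

section Transport

variable {K L : Type*} [TopologicalSpace K] [MeasurableSpace K] [BorelSpace K]
  [TopologicalSpace L] [MeasurableSpace L] [BorelSpace L]

/-- A convolution carried along a homeomorphism. -/
def ConvolutionData.transport (H : ConvolutionData K) (f : K ≃ₜ L) : ConvolutionData L where
  conv x y := (H.conv (f.symm x) (f.symm y)).map f.continuous.measurable.aemeasurable
  e := f H.e
  inv x := f (H.inv (f.symm x))

theorem ConvolutionData.transport_conv (H : ConvolutionData K) (f : K ≃ₜ L) (x y : L) :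
    ((H.transport f).conv x y : Measure L) =
      (H.conv (f.symm x) (f.symm y) : Measure K).map f := rfl

theorem ConvolutionData.integral_transport (H : ConvolutionData K) (f : K ≃ₜ L) (x y : L)
    {E : Type*} [NormedAddCommGroup E] [NormedSpace ℝ E] (g : L → E) :
    ∫ z, g z ∂((H.transport f).conv x y : Measure L) =
      ∫ z, g (f z) ∂(H.conv (f.symm x) (f.symm y) : Measure K) := by
  rw [H.transport_conv]
  exact f.measurableEmbedding.integral_map g

theorem Homeomorph.support_map (f : K ≃ₜ L) (μ : Measure K) :
    (μ.map f).support = f '' μ.support := by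
  ext x
  rw [f.image_eq_preimage_symm, Set.mem_preimage, Measure.mem_support_iff_forall,
    Measure.mem_support_iff_forall]
  constructor
  · intro h U hU
    have := h (f '' U) (by
      rw [f.image_eq_preimage_symm]; exact f.symm.continuous.continuousAt.preimage_mem_nhds hU)
    rwa [f.measurableEmbedding.map_apply, f.injective.preimage_image] at this
  · intro h U hU
    rw [f.measurableEmbedding.map_apply]
    exact h _ (f.continuous.continuousAt.preimage_mem_nhds (by simpa using hU))

omit [MeasurableSpace K] [BorelSpace K] [MeasurableSpace L] [BorelSpace L] in
theorem Homeomorph.continuous_image_vietoris (f : K ≃ₜ L) :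
    @Continuous _ _ (TopologicalSpace.vietoris K) (TopologicalSpace.vietoris L)
      (fun s : Set K => f '' s) := by
  let _ := TopologicalSpace.vietoris K
  let _ := TopologicalSpace.vietoris L
  refine TopologicalSpace.vietoris.continuous_iff.2 ⟨fun U hU => ?_, fun F hF => ?_⟩
  · convert (hU.preimage f.continuous).powerset_vietoris using 1
    ext s; simp
  · convert (hF.preimage f.continuous).powerset_vietoris using 1
    ext s; simp

theorem IsHypergroup.transport {H : ConvolutionData K} (hH : IsHypergroup H) (f : K ≃ₜ L) :
    IsHypergroup (H.transport f) where
  t2 := have := hH.t2; f.symm.isEmbedding.t2Space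
  locallyCompact := have := hH.locallyCompact; f.symm.isClosedEmbedding.locallyCompactSpace
  regular x y := by
    have := hH.regular (f.symm x) (f.symm y)
    exact Measure.Regular.map f
  isCompact_support x y := by
    rw [H.transport_conv, f.support_map]
    exact (hH.isCompact_support _ _).image f.continuous
  continuous_conv :=
    (ProbabilityMeasure.continuous_map f.continuous).comp
      (hH.continuous_conv.comp (f.symm.continuous.prodMap f.symm.continuous))
  continuous_support := by
    let _ := TopologicalSpace.vietoris K
    let _ := TopologicalSpace.vietoris L
    simp_rw [H.transport_conv, f.support_map]
    exact f.continuous_image_vietoris.comp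
      (hH.continuous_support.comp (f.symm.continuous.prodMap f.symm.continuous))
  assoc x y z g := by
    simp_rw [H.integral_transport, f.symm_apply_apply]
    exact hH.assoc (f.symm x) (f.symm y) (f.symm z) (g.compContinuous ⟨f, f.continuous⟩)
  conv_e x := by
    rw [H.transport_conv]
    simp only [ConvolutionData.transport, f.symm_apply_apply, hH.conv_e]
    rw [Measure.map_dirac' f.continuous.measurable, f.apply_symm_apply]
  e_conv x := by
    rw [H.transport_conv]
    simp only [ConvolutionData.transport, f.symm_apply_apply, hH.e_conv]
    rw [Measure.map_dirac' f.continuous.measurable, f.apply_symm_apply]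
  inv_inv x := by simp [ConvolutionData.transport, hH.inv_inv]
  continuous_inv := f.continuous.comp (hH.continuous_inv.comp f.symm.continuous)
  map_inv x y := by
    have hinv : Measurable (H.transport f).inv :=
      (f.continuous.comp (hH.continuous_inv.comp f.symm.continuous)).measurable
    rw [H.transport_conv, H.transport_conv, Measure.map_map hinv f.continuous.measurable]
    simp only [ConvolutionData.transport, f.symm_apply_apply, ← hH.map_inv]
    rw [Measure.map_map f.continuous.measurable hH.continuous_inv.measurable]
    congr 1
    ext z
    simp
  e_mem_support x y := by
    rw [H.transport_conv, f.support_map]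
    simp only [ConvolutionData.transport, f.symm_apply_apply]
    rw [f.injective.mem_set_image, hH.e_mem_support, f.symm.injective.eq_iff]

theorem IsHermitian.transport {H : ConvolutionData K} (hH : IsHermitian H) (f : K ≃ₜ L) :
    IsHermitian (H.transport f) := fun x => by
  simp [ConvolutionData.transport, hH (f.symm x)]

theorem ConvolutionData.isHypergroupIso_transport (H : ConvolutionData K) (f : K ≃ₜ L) :
    IsHypergroupIso H (H.transport f) f where
  map_conv x y := by rw [H.transport_conv, f.symm_apply_apply, f.symm_apply_apply]
  map_e := rfl
  map_inv x := by simp [ConvolutionData.transport]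

end Transport

/-! ### Associativity from separating characters. -/

/-- A convolution on a countable space is associative as soon as its bounded multiplicative
functions separate the probability measures. -/
theorem ConvolutionData.assoc_of_separating {K ι : Type*} [Countable K] [MeasurableSpace K]
    [MeasurableSingletonClass K] (H : ConvolutionData K) (g : ι → K → ℂ)
    (hb : ∀ i, ∃ C : ℝ, ∀ x, ‖g i x‖ ≤ C)
    (hmul : ∀ i x y, ∫ z, g i z ∂(H.conv x y : Measure K) = g i x * g i y)
    (hsep : ∀ μ ν : Measure K, IsProbabilityMeasure μ → IsProbabilityMeasure ν →
      (∀ i, ∫ z, g i z ∂μ = ∫ z, g i z ∂ν) → μ = ν)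
    (x y z : K) (f : K → ℝ) (hf : ∃ C : ℝ, ∀ x, ‖f x‖ ≤ C) :
    ∫ t, (∫ w, f w ∂(H.conv t z : Measure K)) ∂(H.conv x y : Measure K) =
      ∫ t, (∫ w, f w ∂(H.conv x t : Measure K)) ∂(H.conv y z : Measure K) := by
  let k₁ : ProbabilityTheory.Kernel K K :=
    ⟨fun t => (H.conv t z : Measure K), Measurable.of_discrete⟩
  let k₂ : ProbabilityTheory.Kernel K K :=
    ⟨fun t => (H.conv x t : Measure K), Measurable.of_discrete⟩
  have : ProbabilityTheory.IsMarkovKernel k₁ :=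
    ⟨fun t => inferInstanceAs (IsProbabilityMeasure (H.conv t z : Measure K))⟩
  have : ProbabilityTheory.IsMarkovKernel k₂ :=
    ⟨fun t => inferInstanceAs (IsProbabilityMeasure (H.conv x t : Measure K))⟩
  let κ₁ : ProbabilityTheory.Kernel Unit K := .const Unit (H.conv x y : Measure K)
  let κ₂ : ProbabilityTheory.Kernel Unit K := .const Unit (H.conv y z : Measure K)
  have key : ∀ {E : Type} [NormedAddCommGroup E] [NormedSpace ℝ E] [SecondCountableTopology E]
      [MeasurableSpace E] [BorelSpace E] (h : K → E),
      (∃ C : ℝ, ∀ x, ‖h x‖ ≤ C) → ∀ (μ : Measure K) [IsFiniteMeasure μ], Integrable h μ := by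
    rintro E _ _ _ _ _ h ⟨C, hC⟩ μ _
    exact Integrable.of_bound (Measurable.of_discrete.aestronglyMeasurable) C (.of_forall hC)
  have e₁ : ∀ {E : Type} [NormedAddCommGroup E] [NormedSpace ℝ E] [SecondCountableTopology E]
      [MeasurableSpace E] [BorelSpace E] (h : K → E), (∃ C : ℝ, ∀ x, ‖h x‖ ≤ C) →
      ∫ w, h w ∂(k₁.comp κ₁ ()) =
        ∫ t, (∫ w, h w ∂(H.conv t z : Measure K)) ∂(H.conv x y : Measure K) := by
    intro E _ _ _ _ _ h hh
    exact ProbabilityTheory.Kernel.integral_comp (key h hh _)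
  have e₂ : ∀ {E : Type} [NormedAddCommGroup E] [NormedSpace ℝ E] [SecondCountableTopology E]
      [MeasurableSpace E] [BorelSpace E] (h : K → E), (∃ C : ℝ, ∀ x, ‖h x‖ ≤ C) →
      ∫ w, h w ∂(k₂.comp κ₂ ()) =
        ∫ t, (∫ w, h w ∂(H.conv x t : Measure K)) ∂(H.conv y z : Measure K) := by
    intro E _ _ _ _ _ h hh
    exact ProbabilityTheory.Kernel.integral_comp (key h hh _)
  -- Both sides are integrals of `f` against composed probability measures; these agree because each
  -- `g i` integrates to `g i x * g i y * g i z` on both.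
  rw [← e₁ f hf, ← e₂ f hf, hsep (k₁.comp κ₁ ()) (k₂.comp κ₂ ()) inferInstance inferInstance]
  intro i
  rw [e₁ _ (hb i), e₂ _ (hb i)]
  simp_rw [hmul]
  rw [integral_mul_const, integral_const_mul, hmul, hmul, mul_assoc]

/-! ### The matrix of characters. -/

section CharTable

variable {β : ℕ → ℝ}

theorem charTable_of_le {k : ℕ∞} {n : ℕ} (h : (n : ℕ∞) ≤ k) : charTable β k n = 1 := if_pos h

theorem charTable_succ_self (k : ℕ) : charTable β k (k + 1) = β k := by
  have h : ¬ ((k + 1 : ℕ) : ℕ∞) ≤ k := by rw [Nat.cast_le]; omega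
  rw [charTable, if_neg h, if_pos (by push_cast; rfl), ENat.toNat_natCast]

theorem charTable_of_lt {k n : ℕ} (h : k + 1 < n) : charTable β k n = 0 := by
  have h₁ : ¬ (n : ℕ∞) ≤ k := by rw [Nat.cast_le]; omega
  have h₂ : ¬ (n : ℕ∞) = k + 1 := by
    rw [← Nat.cast_one, ← Nat.cast_add, Nat.cast_inj]; omega
  rw [charTable, if_neg h₁, if_neg h₂]

/-- The dependence of `charTable` on its first index, for a fixed nonzero second index. -/
theorem charTable_succ (n : ℕ) (k : ℕ∞) :
    charTable β k (n + 1) = if k < n then 0 else if k = n then β n else 1 := by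
  induction k using ENat.recTopCoe with
  | top => rw [charTable_of_le le_top, if_neg (by simp), if_neg (by simp)]
  | coe k =>
    simp only [Nat.cast_lt, Nat.cast_inj]
    rcases lt_trichotomy k n with h | rfl | h
    · rw [if_pos h, charTable_of_lt (by omega)]
    · rw [if_neg (lt_irrefl _), if_pos rfl, charTable_succ_self]
    · rw [if_neg (by omega), if_neg (by omega), charTable_of_le (by rw [Nat.cast_le]; omega)]

theorem charTable_top (n : ℕ) : charTable β ⊤ n = 1 := charTable_of_le le_top

theorem charTable_zero (k : ℕ∞) : charTable β k 0 = 1 := charTable_of_le (by simp)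

/-- If the entry at `m` is not $1$, then $m>k$, so $n>k+1$ and the entry at `n` vanishes. -/
theorem charTable_mul_of_lt {m n : ℕ} (h : m < n) (k : ℕ∞) :
    charTable β k m * charTable β k n = charTable β k n := by
  induction k using ENat.recTopCoe with
  | top => simp [charTable_top]
  | coe k =>
    by_cases hm : m ≤ k
    · rw [charTable_of_le (k := k) (n := m) (by exact_mod_cast hm), one_mul]
    · rw [charTable_of_lt (k := k) (n := n) (by omega), mul_zero]

/-- A nonzero entry of row `k` at $n$ forces $n\le k+1\le l$, where row `l` is $1$. -/
theorem charTable_mul_of_lt_left {k l : ℕ∞} (h : k < l) (n : ℕ) :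
    charTable β k n * charTable β l n = charTable β k n := by
  rcases n with _ | n
  · simp [charTable_zero]
  · by_cases hl : (n : ℕ∞) < l
    · rw [charTable_of_le (k := l) (by push_cast; exact Order.add_one_le_of_lt hl), mul_one]
    · rw [charTable_succ n k, if_pos (h.trans_le (not_lt.1 hl)), zero_mul]

theorem abs_charTable_le (hβ : ∀ k, |β k| ≤ 1) (k : ℕ∞) (n : ℕ) : |charTable β k n| ≤ 1 := by
  unfold charTable
  split_ifs <;> simp [hβ]

end CharTable

/-! ### Superincreasing sequences and the coefficients $\gamma$. -/

/-- A positive sequence each of whose terms dominates the sum of the previous ones. -/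
structure IsSuperincreasing (a : ℕ → ℝ) : Prop where
  pos : ∀ n, 0 < a n
  sum_le : ∀ n, ∑ j ∈ Finset.range n, a j ≤ a n

/-- The numbers `-(a 0 + ⋯ + a k) / a (k + 1)`. -/
def negRatio (a : ℕ → ℝ) (k : ℕ) : ℝ := -(∑ j ∈ Finset.range (k + 1), a j) / a (k + 1)

namespace IsSuperincreasing

variable {a : ℕ → ℝ} (ha : IsSuperincreasing a)
include ha

theorem sum_pos (n : ℕ) : 0 < ∑ j ∈ Finset.range (n + 1), a j :=
  Finset.sum_pos (fun j _ => ha.pos j) ⟨0, by simp⟩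

theorem negRatio_neg (k : ℕ) : negRatio a k < 0 :=
  div_neg_of_neg_of_pos (neg_lt_zero.2 (ha.sum_pos k)) (ha.pos _)

theorem neg_one_le_negRatio (k : ℕ) : -1 ≤ negRatio a k := by
  rw [negRatio, le_div_iff₀ (ha.pos _)]
  linarith [ha.sum_le (k + 1)]

theorem abs_negRatio_le (k : ℕ) : |negRatio a k| ≤ 1 :=
  abs_le.2 ⟨ha.neg_one_le_negRatio k, by linarith [ha.negRatio_neg k]⟩

theorem negRatio_mul (k : ℕ) :
    a (k + 1) * negRatio a k = -∑ j ∈ Finset.range (k + 1), a j :=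
  mul_div_cancel₀ _ (ha.pos _).ne'

theorem mul_le_sum (n : ℕ) : n * a 0 ≤ ∑ j ∈ Finset.range n, a j := by
  induction n with
  | zero => simp
  | succ n ih =>
    rw [Finset.sum_range_succ]
    rcases n with _ | n
    · simp
    · have h₁ := ha.sum_le (n + 1)
      have h₂ : a 0 ≤ ∑ j ∈ Finset.range (n + 1), a j :=
        Finset.single_le_sum (fun j _ => (ha.pos j).le) (by simp)
      push_cast at ih ⊢
      linarith

theorem tendsto_sum_atTop :
    Filter.Tendsto (fun n => ∑ j ∈ Finset.range n, a j) Filter.atTop Filter.atTop :=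
  Filter.tendsto_atTop_mono ha.mul_le_sum
    (tendsto_natCast_atTop_atTop.atTop_mul_const (ha.pos 0))

omit ha in
theorem gammaCoeff_of_lt {β : ℕ → ℝ} {m j : ℕ} (h : j < m) : gammaCoeff β m j = 0 := if_pos h

omit ha in
theorem gammaCoeff_self {β : ℕ → ℝ} (m : ℕ) : gammaCoeff β m m = 1 + β m := by
  simp [gammaCoeff]

theorem gammaCoeff_self_nonneg (m : ℕ) : 0 ≤ gammaCoeff (negRatio a) m m := by
  rw [gammaCoeff_self]
  linarith [ha.neg_one_le_negRatio m]

theorem gammaCoeff_pos {m j : ℕ} (h : m < j) : 0 < gammaCoeff (negRatio a) m j := by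
  rw [gammaCoeff, if_neg (by omega), if_neg (by omega)]
  exact Finset.prod_pos fun i _ => div_pos (neg_pos.2 (ha.negRatio_neg i))
    (by linarith [ha.negRatio_neg (i + 1)])

theorem gammaCoeff_nonneg (m j : ℕ) : 0 ≤ gammaCoeff (negRatio a) m j := by
  rcases lt_trichotomy j m with h | rfl | h
  · rw [gammaCoeff_of_lt h]
  · exact ha.gammaCoeff_self_nonneg j
  · exact (ha.gammaCoeff_pos h).le

/-- Here $1-\beta_{i+1}=A_{i+3}/a_{i+2}$. In this form a product over `i` telescopes in $a$ with
step one and in $A$ with step two, leaving only boundary terms. -/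
theorem neg_negRatio_div (i : ℕ) :
    -negRatio a i / (1 - negRatio a (i + 1)) =
      (∑ j ∈ Finset.range (i + 1), a j) * a (i + 2) /
        (a (i + 1) * ∑ j ∈ Finset.range (i + 3), a j) := by
  have h₁ := (ha.pos (i + 1)).ne'
  have h₂ := (ha.pos (i + 2)).ne'
  have h₃ := (ha.sum_pos (i + 2)).ne'
  have h₄ : 1 - negRatio a (i + 1) = (∑ j ∈ Finset.range (i + 3), a j) / a (i + 2) := by
    rw [negRatio, Finset.sum_range_succ _ (i + 2)]
    field_simp
    ring
  rw [h₄, negRatio]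
  field_simp

theorem gammaCoeff_add (m r : ℕ) :
    gammaCoeff (negRatio a) m (m + 1 + r) =
      (∑ j ∈ Finset.range (m + 1), a j) * (∑ j ∈ Finset.range (m + 2), a j) / a (m + 1) *
        (a (m + r + 2) / ((∑ j ∈ Finset.range (m + r + 2), a j) *
          ∑ j ∈ Finset.range (m + r + 3), a j)) := by
  rw [gammaCoeff, if_neg (by omega), if_neg (by omega)]
  induction r with
  | zero =>
    rw [add_zero, Nat.Ico_succ_singleton, Finset.prod_singleton, ha.neg_negRatio_div]
    have h₁ := (ha.pos (m + 1)).ne'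
    have h₂ := (ha.sum_pos (m + 1)).ne'
    have h₃ := (ha.sum_pos (m + 2)).ne'
    simp only [add_zero]
    field_simp
  | succ r ih =>
    rw [← add_assoc, Finset.prod_Ico_succ_top (by omega), ih, ha.neg_negRatio_div,
      show m + 1 + r = m + r + 1 by ring, show m + (r + 1) = m + r + 1 by ring]
    have h₁ := (ha.pos (m + 1)).ne'
    have h₂ := (ha.sum_pos (m + r + 1)).ne'
    have h₃ := (ha.sum_pos (m + r + 2)).ne'
    have h₄ := (ha.sum_pos (m + r + 3)).ne'
    have h₅ := (ha.pos (m + r + 2)).ne'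
    simp only [add_assoc, Nat.reduceAdd] at *
    field_simp

/-- Since $a_{j+1}=A_{j+2}-A_{j+1}$, the closed form of $\gamma^m_j$ is $C_m(1/A_{j+1}-1/A_{j+2})$
and the sum telescopes. It starts from $1+\beta_m=1-C_m/A_{m+2}$. -/
theorem sum_gammaCoeff (m r : ℕ) :
    ∑ j ∈ Finset.range (m + 1 + r), gammaCoeff (negRatio a) m j =
      1 - (∑ j ∈ Finset.range (m + 1), a j) * (∑ j ∈ Finset.range (m + 2), a j) / a (m + 1) /
        ∑ j ∈ Finset.range (m + r + 2), a j := by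
  induction r with
  | zero =>
    have h₁ := (ha.pos (m + 1)).ne'
    have h₂ := (ha.sum_pos (m + 1)).ne'
    rw [add_zero, Finset.sum_range_succ, gammaCoeff_self, Finset.sum_eq_zero
      (fun j hj => gammaCoeff_of_lt (Finset.mem_range.1 hj)), negRatio]
    simp only [add_zero]
    field_simp
    ring
  | succ r ih =>
    rw [← add_assoc, Finset.sum_range_succ, ih, ha.gammaCoeff_add,
      show m + (r + 1) + 2 = m + r + 3 by ring]
    have h₁ := (ha.pos (m + 1)).ne'
    have h₂ := (ha.sum_pos (m + r + 1)).ne'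
    have h₃ := (ha.sum_pos (m + r + 2)).ne'
    have h₄ : a (m + r + 2) = (∑ j ∈ Finset.range (m + r + 3), a j) -
        ∑ j ∈ Finset.range (m + r + 2), a j := by
      rw [Finset.sum_range_succ _ (m + r + 2)]; ring
    rw [h₄]
    field_simp
    ring

theorem hasSum_gammaCoeff (m : ℕ) : HasSum (gammaCoeff (negRatio a) m) 1 := by
  rw [hasSum_iff_tendsto_nat_of_nonneg (ha.gammaCoeff_nonneg m),
    ← Filter.tendsto_add_atTop_iff_nat (m + 1)]
  have h := (ha.tendsto_sum_atTop.comp (Filter.tendsto_add_atTop_nat (m + 2))).const_div_atTop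
    ((∑ j ∈ Finset.range (m + 1), a j) * (∑ j ∈ Finset.range (m + 2), a j) / a (m + 1))
  have h' := h.const_sub 1
  rw [sub_zero] at h'
  refine h'.congr fun r => ?_
  rw [show r + (m + 1) = m + 1 + r by ring, ha.sum_gammaCoeff]
  simp only [Function.comp]
  rw [show r + (m + 2) = m + r + 2 by ring]

/-- The tails of the coefficients `γ^m` pair to zero with `negRatio a` beyond the diagonal. -/
theorem gammaCoeff_tail (m r : ℕ) :
    negRatio a (m + 1 + r) *
        (1 - ∑ j ∈ Finset.range (m + 1 + r), gammaCoeff (negRatio a) m j) +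
      (1 - negRatio a (m + 1 + r)) *
        (1 - ∑ j ∈ Finset.range (m + 1 + r + 1), gammaCoeff (negRatio a) m j) = 0 := by
  -- With $n=m+1+r$, the two tails are $C_m/A_{n+1}$ and $C_m/A_{n+2}$, whose ratio is
  -- $A_{n+1}/A_{n+2}=-\beta_n/(1-\beta_n)$.
  rw [add_assoc (m + 1) r 1, ha.sum_gammaCoeff, ha.sum_gammaCoeff,
    show m + (r + 1) + 2 = m + r + 3 by ring, negRatio, show m + 1 + r + 1 = m + r + 2 by ring,
    Finset.sum_range_succ _ (m + r + 2)]
  have h₁ := (ha.pos (m + 1)).ne'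
  have h₂ := (ha.sum_pos (m + r + 1)).ne'
  have h₃ := (ha.sum_pos (m + r + 2)).ne'
  have h₅ := (ha.pos (m + r + 2)).ne'
  rw [Finset.sum_range_succ _ (m + r + 2)] at h₃
  field_simp
  ring

end IsSuperincreasing

open Filter Topology in
theorem MeasureTheory.Measure.support_dirac_of_t1 {X : Type*} [TopologicalSpace X] [T1Space X]
    [MeasurableSpace X] [MeasurableSingletonClass X] (x : X) :
    (Measure.dirac x).support = {x} := by
  ext y
  rw [Measure.mem_support_iff_forall, Set.mem_singleton_iff]
  constructor
  · intro h
    by_contra hne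
    have := h {x}ᶜ (isOpen_compl_singleton.mem_nhds hne)
    simp at this
  · rintro rfl U hU
    simp [mem_of_mem_nhds hU]

instance ENat.instBorelSpace : BorelSpace ℕ∞ where
  measurable_eq := by
    refine le_antisymm (fun s _ => ?_) (fun _ _ => trivial)
    borelize ℕ∞
    rw [← Set.biUnion_of_singleton s]
    exact .biUnion s.to_countable fun x _ => isClosed_singleton.measurableSet

/-! ### Deformations of the min semigroup on $\mathbb Z_+^*$ as hypergroups. -/

/-- The deformation of the "min" semigroup `ℤ₊ ∪ {∞}` along its finite diagonal by the
probability measures `p m`. -/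
def minDeformation (p : ℕ → PMF ℕ) : ConvolutionData ℕ∞ where
  conv m n :=
    ⟨(if m = n ∧ n ≠ ⊤ then (p n.toNat).map Nat.cast else PMF.pure (min m n)).toMeasure,
      inferInstance⟩
  e := ⊤
  inv := id

namespace minDeformation

open Filter Topology

variable {p : ℕ → PMF ℕ}

theorem conv_of_ne {m n : ℕ∞} (h : m ≠ n ∨ (m = ⊤ ∧ n = ⊤)) :
    (minDeformation p).conv m n = diracProba (min m n) := by
  apply Subtype.ext
  change (if m = n ∧ n ≠ ⊤ then (p n.toNat).map Nat.cast else PMF.pure (min m n)).toMeasure =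
    Measure.dirac (min m n)
  rw [if_neg (by rcases h with h | h <;> simp [h]), PMF.toMeasure_pure]

theorem coe_conv_of_ne {m n : ℕ∞} (h : m ≠ n ∨ (m = ⊤ ∧ n = ⊤)) :
    ((minDeformation p).conv m n : Measure ℕ∞) = Measure.dirac (min m n) := by
  rw [conv_of_ne h]; rfl

theorem conv_self (m : ℕ) :
    ((minDeformation p).conv m m : Measure ℕ∞) = (p m).toMeasure.map Nat.cast := by
  change (if (m : ℕ∞) = m ∧ (m : ℕ∞) ≠ ⊤ then (p (m : ℕ∞).toNat).map Nat.cast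
    else PMF.pure (min (m : ℕ∞) m)).toMeasure = _
  rw [if_pos (by simp), ← PMF.toMeasure_map Nat.cast _ Measurable.of_discrete, ENat.toNat_natCast]

theorem conv_self_eq_sum (m : ℕ) :
    ((minDeformation p).conv m m : Measure ℕ∞) =
      Measure.sum fun j : ℕ => p m j • Measure.dirac (j : ℕ∞) := by
  rw [conv_self, ← Measure.sum_smul_dirac (p m).toMeasure,
    Measure.map_sum Measurable.of_discrete.aemeasurable]
  congr 1
  ext1 j
  rw [Measure.map_smul, Measure.map_dirac, (p m).toMeasure_apply_singleton _ (.singleton j)]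

theorem conv_self_Iio (m n : ℕ) :
    ((minDeformation p).conv m m : Measure ℕ∞) (Set.Iio n) = ∑ j ∈ Finset.range n, p m j := by
  rw [conv_self, Measure.map_apply Measurable.of_discrete .of_discrete,
    ← PMF.toMeasure_apply_finset]
  congr 1
  ext j
  simp

theorem conv_self_real_Ici (m n : ℕ) :
    ((minDeformation p).conv m m : Measure ℕ∞).real (Set.Ici n) =
      1 - ∑ j ∈ Finset.range n, (p m j).toReal := by
  rw [← Set.compl_Iio, probReal_compl_eq_one_sub .of_discrete, Measure.real, conv_self_Iio,
    ENNReal.toReal_sum fun j _ => (p m).apply_ne_top j]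

theorem conv_comm (m n : ℕ∞) : (minDeformation p).conv m n = (minDeformation p).conv n m := by
  by_cases h : m = n
  · rw [h]
  · rw [conv_of_ne (.inl h), conv_of_ne (.inl (Ne.symm h)), min_comm]

variable (hp : ∀ m j, j < m → p m j = 0)
include hp

/-- This drives both continuity proofs at $(\infty,\infty)$: the measures are squeezed into
$[\min(m,n),\infty]$. -/
theorem conv_Iio_min (m n : ℕ∞) :
    ((minDeformation p).conv m n : Measure ℕ∞) (Set.Iio (min m n)) = 0 := by
  by_cases h : m ≠ n ∨ (m = ⊤ ∧ n = ⊤)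
  · rw [coe_conv_of_ne h]
    simp
  · push Not at h
    obtain ⟨rfl, h⟩ := h
    lift m to ℕ using (fun hm => h hm hm)
    rw [min_self, conv_self_Iio]
    exact Finset.sum_eq_zero fun j hj => hp m j (Finset.mem_range.1 hj)

theorem support_conv_subset (m n : ℕ∞) :
    ((minDeformation p).conv m n : Measure ℕ∞).support ⊆ Set.Ici (min m n) :=
  Measure.support_subset_of_isClosed isClosed_Ici
    (by rw [mem_ae_iff, Set.compl_Ici]; exact conv_Iio_min hp m n)

omit hp in
-- Finite points are isolated and $\min(m,k)=m$ once $k>m$, so the convolution is locally constant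
-- away from $(\infty,\infty)$, the only point where continuity needs an argument.
theorem eq_or_eventually_conv_eq (x : ℕ∞ × ℕ∞) :
    x = (⊤, ⊤) ∨ ∀ᶠ y in 𝓝 x, (minDeformation p).conv y.1 y.2 =
      (minDeformation p).conv x.1 x.2 := by
  have key : ∀ m : ℕ, ∀ᶠ y in 𝓝 ((m : ℕ∞), (⊤ : ℕ∞)), (minDeformation p).conv y.1 y.2 =
      (minDeformation p).conv m ⊤ := by
    intro m
    rw [nhds_prod_eq, ENat.nhds_natCast]
    have h₁ : ∀ᶠ k : ℕ∞ in pure (m : ℕ∞), k = m := by simp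
    have h₂ : ∀ᶠ k : ℕ∞ in 𝓝 ⊤, (m : ℕ∞) < k := lt_mem_nhds (ENat.natCast_lt_top m)
    filter_upwards [h₁.prod_mk h₂] with y ⟨hy₁, hy₂⟩
    rw [hy₁, conv_of_ne (.inl hy₂.ne), conv_of_ne (.inl (ENat.natCast_ne_top m)),
      min_eq_left hy₂.le, min_eq_left le_top]
  obtain ⟨m, n⟩ := x
  induction m using ENat.recTopCoe with
  | top =>
    induction n using ENat.recTopCoe with
    | top => exact .inl rfl
    | coe n =>
      refine .inr ?_
      have h := (continuous_swap.tendsto ((⊤ : ℕ∞), (n : ℕ∞))).eventually (key n)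
      filter_upwards [h] with y hy
      rw [conv_comm, conv_comm ⊤]
      exact hy
  | coe m =>
    induction n using ENat.recTopCoe with
    | top => exact .inr (key m)
    | coe n => exact .inr (by simp [nhds_prod_eq])

theorem continuous_conv :
    Continuous fun x : ℕ∞ × ℕ∞ => (minDeformation p).conv x.1 x.2 := by
  refine continuous_iff_continuousAt.2 fun x => ?_
  rcases eq_or_eventually_conv_eq (p := p) x with rfl | h
  · rw [ContinuousAt, ProbabilityMeasure.tendsto_iff_forall_integral_tendsto]
    intro f
    rw [coe_conv_of_ne (.inr ⟨rfl, rfl⟩), integral_dirac, min_self, Metric.tendsto_nhds]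
    intro ε hε
    have h₁ : ∀ᶠ k in 𝓝 (⊤ : ℕ∞), dist (f k) (f ⊤) < ε / 2 :=
      Metric.tendsto_nhds.1 (f.continuous.tendsto ⊤) _ (half_pos hε)
    obtain ⟨l, hl, hlf⟩ := exists_Ioc_subset_of_mem_nhds h₁ ⟨0, by simp⟩
    have h₂ : ∀ᶠ y : ℕ∞ × ℕ∞ in 𝓝 (⊤, ⊤), l < min y.1 y.2 :=
      ((continuous_fst.min continuous_snd).tendsto ((⊤ : ℕ∞), (⊤ : ℕ∞))).eventually
        (lt_mem_nhds (by simpa using hl))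
    filter_upwards [h₂] with y hy
    have h₃ : ∀ᵐ k ∂((minDeformation p).conv y.1 y.2 : Measure ℕ∞),
        ‖f k - f ⊤‖ ≤ ε / 2 := by
      have : Set.Ici (min y.1 y.2) ∈ ae ((minDeformation p).conv y.1 y.2 : Measure ℕ∞) := by
        rw [mem_ae_iff, Set.compl_Ici]; exact conv_Iio_min hp _ _
      filter_upwards [this] with k hk
      rw [← dist_eq_norm]
      exact (hlf ⟨hy.trans_le hk, le_top⟩ : dist (f k) (f ⊤) < ε / 2).le
    have h₄ := norm_integral_le_of_norm_le_const h₃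
    rw [integral_sub (f.integrable _) (integrable_const _), integral_const, probReal_univ,
      one_smul, mul_one] at h₄
    rw [dist_eq_norm]
    linarith
  · exact tendsto_nhds_of_eventually_eq h

theorem continuous_support :
    @Continuous (ℕ∞ × ℕ∞) (Set ℕ∞) _ (TopologicalSpace.vietoris ℕ∞)
      fun x => ((minDeformation p).conv x.1 x.2 : Measure ℕ∞).support := by
  let _ := TopologicalSpace.vietoris ℕ∞
  refine continuous_iff_continuousAt.2 fun x => ?_
  rcases eq_or_eventually_conv_eq (p := p) x with rfl | h
  · rw [ContinuousAt, TopologicalSpace.tendsto_nhds_generateFrom_iff]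
    have h₀ : ((minDeformation p).conv ⊤ ⊤ : Measure ℕ∞).support = {⊤} := by
      rw [coe_conv_of_ne (.inr ⟨rfl, rfl⟩), Measure.support_dirac_of_t1, min_self]
    have key : ∀ U : Set ℕ∞, IsOpen U → ⊤ ∈ U → ∀ᶠ y : ℕ∞ × ℕ∞ in 𝓝 (⊤, ⊤),
        ((minDeformation p).conv y.1 y.2 : Measure ℕ∞).support ⊆ U := by
      intro U hU htU
      obtain ⟨l, hl, hlU⟩ := exists_Ioc_subset_of_mem_nhds (hU.mem_nhds htU) ⟨0, by simp⟩
      have h₂ : ∀ᶠ y : ℕ∞ × ℕ∞ in 𝓝 (⊤, ⊤), l < min y.1 y.2 :=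
        ((continuous_fst.min continuous_snd).tendsto ((⊤ : ℕ∞), (⊤ : ℕ∞))).eventually
          (lt_mem_nhds (by simpa using hl))
      filter_upwards [h₂] with y hy
      exact (support_conv_subset hp _ _).trans fun k hk => hlU ⟨hy.trans_le hk, le_top⟩
    rintro _ (⟨U, hU, rfl⟩ | ⟨U, hU, rfl⟩) hmem
    · exact key U hU (hmem (by rw [h₀]; rfl))
    · have htU : ⊤ ∈ U := by
        obtain ⟨z, hz, hzU⟩ := hmem
        rw [h₀] at hz
        rwa [← Set.mem_singleton_iff.1 hz]
      filter_upwards [key U hU htU] with y hy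
      obtain ⟨z, hz⟩ := Measure.nonempty_support
        (IsProbabilityMeasure.ne_zero ((minDeformation p).conv y.1 y.2 : Measure ℕ∞))
      exact ⟨z, hz, hy hz⟩
  · exact tendsto_nhds_of_eventually_eq (h.mono fun y hy => by rw [hy])

theorem isHypergroup (hp' : ∀ m j, m < j → p m j ≠ 0)
    (hassoc : ∀ (x y z : ℕ∞) (f : BoundedContinuousFunction ℕ∞ ℝ),
      ∫ t, (∫ w, f w ∂((minDeformation p).conv t z : Measure ℕ∞))
          ∂((minDeformation p).conv x y : Measure ℕ∞) =
        ∫ t, (∫ w, f w ∂((minDeformation p).conv x t : Measure ℕ∞))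
          ∂((minDeformation p).conv y z : Measure ℕ∞)) :
    IsHypergroup (minDeformation p) where
  t2 := inferInstance
  locallyCompact := inferInstance
  regular x y := inferInstance
  isCompact_support x y := Measure.isClosed_support.isCompact
  continuous_conv := continuous_conv hp
  continuous_support := continuous_support hp
  assoc := hassoc
  conv_e x := by
    change ((minDeformation p).conv x ⊤ : Measure ℕ∞) = _
    rw [coe_conv_of_ne (by by_cases h : x = ⊤ <;> simp [h]), min_eq_left le_top]
  e_conv x := by
    change ((minDeformation p).conv ⊤ x : Measure ℕ∞) = _
    rw [coe_conv_of_ne (by by_cases h : x = ⊤ <;> simp [h, Ne.symm]), min_eq_right le_top]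
  inv_inv x := rfl
  continuous_inv := continuous_id
  map_inv x y := by
    change ((minDeformation p).conv x y : Measure ℕ∞).map id =
      ((minDeformation p).conv y x : Measure ℕ∞)
    rw [Measure.map_id, conv_comm]
  e_mem_support x y := by
    change ⊤ ∈ ((minDeformation p).conv x y : Measure ℕ∞).support ↔ x = y
    by_cases h : x ≠ y ∨ (x = ⊤ ∧ y = ⊤)
    · rw [coe_conv_of_ne h, Measure.support_dirac_of_t1, Set.mem_singleton_iff, eq_comm,
        min_eq_top]
      refine ⟨fun h' => h'.1.trans h'.2.symm, fun h' => h.resolve_left (not_not.2 h')⟩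
    · push Not at h
      obtain ⟨rfl, h⟩ := h
      lift x to ℕ using (fun hx => h hx hx)
      refine iff_of_true ((Measure.mem_support_iff_forall _).2 fun U hU => ?_) rfl
      -- The measure has no mass at $\infty$ itself, but it charges every $j>x$, and these
      -- accumulate at $\infty$. The index `x + l + 1` exceeds both `x` and `l`.
      obtain ⟨l, hl, hlU⟩ := exists_Ioc_subset_of_mem_nhds hU ⟨0, by simp⟩
      lift l to ℕ using hl.ne
      rw [conv_self]
      rw [Measure.map_apply Measurable.of_discrete .of_discrete]
      have hmem : x + l + 1 ∈ (Nat.cast ⁻¹' U : Set ℕ) :=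
        hlU ⟨by exact_mod_cast (by omega : l < x + l + 1), le_top⟩
      refine lt_of_lt_of_le (pos_iff_ne_zero.2 (hp' x (x + l + 1) (by omega))) ?_
      rw [← (p x).toMeasure_apply_singleton _ (.singleton _)]
      exact measure_mono (Set.singleton_subset_iff.2 hmem)

end minDeformation

/-! ### The convolution with coefficients $\gamma$ and its characters. -/

/-- The integrand is $c\,1_{[n,\infty]}+(1-c)\,1_{[n+1,\infty]}$, so columns see a measure only
through its tail masses. -/
theorem integral_step (μ : Measure ℕ∞) [IsProbabilityMeasure μ] (n : ℕ) (c : ℂ) :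
    ∫ k : ℕ∞, (if k < n then 0 else if k = n then c else 1) ∂μ =
      c * μ.real (Set.Ici n) + (1 - c) * μ.real (Set.Ici ((n + 1 : ℕ) : ℕ∞)) := by
  have h : (fun k : ℕ∞ => if k < n then 0 else if k = n then c else 1) = fun k =>
      (Set.Ici (n : ℕ∞)).indicator (fun _ => c) k +
        (Set.Ici ((n + 1 : ℕ) : ℕ∞)).indicator (fun _ => 1 - c) k := by
    ext k
    simp only [Set.indicator_apply, Set.mem_Ici, Nat.cast_succ,
      ENat.add_one_le_iff (ENat.natCast_ne_top n)]
    rcases lt_trichotomy k n with h | rfl | h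
    · rw [if_pos h, if_neg h.not_ge, if_neg h.le.not_gt, add_zero]
    · simp
    · rw [if_neg h.le.not_gt, if_neg h.ne', if_pos h.le, if_pos h, add_sub_cancel]
  rw [h, integral_add ((integrable_const c).indicator .of_discrete)
    ((integrable_const (1 - c)).indicator .of_discrete),
    integral_indicator_const _ .of_discrete, integral_indicator_const _ .of_discrete,
    Complex.real_smul, Complex.real_smul]
  ring

theorem charTable_succ_ofReal {β : ℕ → ℝ} (n : ℕ) (k : ℕ∞) :
    (charTable β k (n + 1) : ℂ) = if k < n then 0 else if k = n then (β n : ℂ) else 1 := by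
  rw [charTable_succ]
  split_ifs <;> simp

/-- Probability measures on `ℤ₊ ∪ {∞}` are determined by their integrals against the columns of
`charTable`. -/
theorem eq_of_integral_charTable_eq {β : ℕ → ℝ} (hβ : ∀ k, β k < 0) (μ ν : Measure ℕ∞)
    [IsProbabilityMeasure μ] [IsProbabilityMeasure ν]
    (h : ∀ n : ℕ, ∫ k, (charTable β k n : ℂ) ∂μ = ∫ k, (charTable β k n : ℂ) ∂ν) : μ = ν := by
  have key : ∀ n : ℕ, μ.real (Set.Ici n) = ν.real (Set.Ici n) := by
    intro n
    induction n with
    | zero =>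
      have : Set.Ici ((0 : ℕ) : ℕ∞) = Set.univ := by ext; simp
      rw [this, probReal_univ, probReal_univ]
    | succ n ih =>
      -- The system for the tail masses is triangular: column $n+1$ yields the mass of
      -- $[n+1,\infty]$ from that of $[n,\infty]$, because $1-\beta_n\ne0$.
      have h₁ := h (n + 1)
      simp_rw [charTable_succ_ofReal, integral_step, ih] at h₁
      have h₂ : (1 - (β n : ℂ)) ≠ 0 := by
        exact_mod_cast (by linarith [hβ n] : (1 - β n) ≠ 0)
      exact_mod_cast mul_left_cancel₀ h₂ (add_left_cancel h₁)
  refine Measure.ext_of_Iic μ ν fun x => ?_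
  induction x using ENat.recTopCoe with
  | top => simp
  | coe n =>
    have hs : Set.Iic (n : ℕ∞) = (Set.Ici ((n + 1 : ℕ) : ℕ∞))ᶜ := by
      ext k
      rw [Set.mem_Iic, Set.mem_compl_iff, Set.mem_Ici, Nat.cast_succ,
        ENat.add_one_le_iff (ENat.natCast_ne_top n), not_lt]
    rw [← measureReal_eq_measureReal_iff, hs, probReal_compl_eq_one_sub .of_discrete,
      probReal_compl_eq_one_sub .of_discrete, key]

namespace IsSuperincreasing

variable {a : ℕ → ℝ} (ha : IsSuperincreasing a)

/-- The coefficients `γ^m` as a probability distribution. -/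
def gammaPMF (m : ℕ) : PMF ℕ :=
  ⟨fun j => ENNReal.ofReal (gammaCoeff (negRatio a) m j), by
    rw [← ENNReal.ofReal_one, ← (ha.hasSum_gammaCoeff m).tsum_eq,
      ENNReal.ofReal_tsum_of_nonneg (ha.gammaCoeff_nonneg m) (ha.hasSum_gammaCoeff m).summable]
    exact ENNReal.summable.hasSum⟩

theorem gammaPMF_apply (m j : ℕ) :
    ha.gammaPMF m j = ENNReal.ofReal (gammaCoeff (negRatio a) m j) := rfl

theorem toReal_gammaPMF (m j : ℕ) :
    (ha.gammaPMF m j).toReal = gammaCoeff (negRatio a) m j :=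
  ENNReal.toReal_ofReal (ha.gammaCoeff_nonneg m j)

/-- The convolution on `ℤ₊ ∪ {∞}` with diagonal coefficients `γ`. -/
def dualConv : ConvolutionData ℕ∞ := minDeformation ha.gammaPMF

theorem dualConv_real_Ici (m n : ℕ) :
    (ha.dualConv.conv m m : Measure ℕ∞).real (Set.Ici n) =
      1 - ∑ j ∈ Finset.range n, gammaCoeff (negRatio a) m j := by
  simp_rw [dualConv, minDeformation.conv_self_real_Ici, ha.toReal_gammaPMF]

omit ha in
theorem sum_gammaCoeff_of_le {β : ℕ → ℝ} {m n : ℕ} (h : n ≤ m) :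
    ∑ j ∈ Finset.range n, gammaCoeff β m j = 0 :=
  Finset.sum_eq_zero fun _ hj => gammaCoeff_of_lt ((Finset.mem_range.1 hj).trans_le h)

omit ha in
theorem sum_gammaCoeff_succ_self {β : ℕ → ℝ} (m : ℕ) :
    ∑ j ∈ Finset.range (m + 1), gammaCoeff β m j = 1 + β m := by
  rw [Finset.sum_range_succ, sum_gammaCoeff_of_le le_rfl, gammaCoeff_self, zero_add]

/-- On the diagonal at a finite $x$, let $T_i$ be the tail of $\gamma^x$ from $i$. Column $n+1$
integrates to $\beta_nT_n+(1-\beta_n)T_{n+1}$. This is $1$ for $n<x$; it is $\beta_x^2$ for $n=x$,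
as $T_x=1$ and $T_{x+1}=-\beta_x$; and it is $0$ for $n>x$ by `gammaCoeff_tail`. -/
theorem integral_charTable_dualConv (n : ℕ) (x y : ℕ∞) :
    ∫ k, (charTable (negRatio a) k n : ℂ) ∂(ha.dualConv.conv x y : Measure ℕ∞) =
      charTable (negRatio a) x n * charTable (negRatio a) y n := by
  by_cases h : x ≠ y ∨ (x = ⊤ ∧ y = ⊤)
  · rw [dualConv, minDeformation.coe_conv_of_ne h, integral_dirac, ← Complex.ofReal_mul]
    congr 1
    rcases lt_trichotomy x y with hlt | rfl | hlt
    · rw [min_eq_left hlt.le, charTable_mul_of_lt_left hlt]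
    · obtain rfl : x = ⊤ := by simpa using h
      simp [charTable_top]
    · rw [min_eq_right hlt.le, mul_comm, charTable_mul_of_lt_left hlt]
  · push Not at h
    obtain ⟨rfl, h⟩ := h
    lift x to ℕ using (fun hx => h hx hx)
    rcases n with _ | n
    · simp [charTable_zero]
    simp_rw [charTable_succ_ofReal (n := n), integral_step, dualConv_real_Ici]
    simp only [Nat.cast_lt, Nat.cast_inj]
    rcases lt_trichotomy x n with hx | rfl | hx
    · obtain ⟨r, rfl⟩ := Nat.exists_eq_add_of_le (Nat.succ_le_of_lt hx)
      rw [if_pos (by omega), mul_zero]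
      exact_mod_cast ha.gammaCoeff_tail x r
    · rw [if_neg (lt_irrefl _), if_pos rfl, sum_gammaCoeff_of_le le_rfl,
        sum_gammaCoeff_succ_self]
      push_cast
      ring
    · rw [if_neg (by omega), if_neg (by omega), sum_gammaCoeff_of_le hx.le,
        sum_gammaCoeff_of_le hx]
      push_cast
      ring

theorem isHypergroup_dualConv : IsHypergroup ha.dualConv := by
  refine minDeformation.isHypergroup (fun m j h => ?_) (fun m j h => ?_) fun x y z f => ?_
  · rw [gammaPMF_apply, gammaCoeff_of_lt h, ENNReal.ofReal_zero]
  · rw [gammaPMF_apply]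
    exact (ENNReal.ofReal_pos.2 (ha.gammaCoeff_pos h)).ne'
  · exact ConvolutionData.assoc_of_separating ha.dualConv
      (fun (n : ℕ) k => (charTable (negRatio a) k n : ℂ))
      (fun n => ⟨1, fun k => by
        rw [Complex.norm_real]; exact abs_charTable_le ha.abs_negRatio_le k n⟩)
      ha.integral_charTable_dualConv
      (fun μ ν _ _ h => eq_of_integral_charTable_eq ha.negRatio_neg μ ν h) x y z f
      ⟨‖f‖, f.norm_coe_le_norm⟩

open Filter Topology in
/-- The continuous characters of `ha.dualConv` are the columns of `charTable`. -/
theorem exists_eq_charTable_column (ξ : C(ℕ∞, ℂ)) (h₀ : ξ ≠ 0)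
    (hmul : ∀ x y, ∫ k, ξ k ∂(ha.dualConv.conv x y : Measure ℕ∞) = ξ x * ξ y) :
    ∃ n : ℕ, ∀ k, ξ k = charTable (negRatio a) k n := by
  have hlt : ∀ x y : ℕ∞, x < y → ξ x = ξ x * ξ y := fun x y hxy => by
    rw [← hmul, dualConv, minDeformation.coe_conv_of_ne (.inl hxy.ne), integral_dirac,
      min_eq_left hxy.le]
  have htop : ξ ⊤ = 1 := by
    by_contra hne
    have htt : ξ ⊤ = 0 := by
      have h := hmul ⊤ ⊤
      rw [dualConv, minDeformation.coe_conv_of_ne (.inr ⟨rfl, rfl⟩), integral_dirac,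
        min_self] at h
      by_contra h'
      exact hne (mul_left_cancel₀ h' (by rw [← h, mul_one]))
    refine h₀ (ContinuousMap.ext fun x => ?_)
    by_cases hx : x = ⊤
    · rw [hx, htt]; rfl
    · rw [hlt x ⊤ (lt_top_iff_ne_top.2 hx), htt, mul_zero]; rfl
  have hzero : ∀ x y : ℕ∞, x < y → ξ y ≠ 1 → ξ x = 0 := fun x y hxy hy => by
    by_contra hx
    exact hy (mul_left_cancel₀ hx (by rw [← hlt x y hxy, mul_one]))
  -- Continuity at $\infty$ enters here: a value other than $1$ at `k` kills everything below `k`,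
  -- while `ξ` does not vanish near $\infty$. So the indices with `ξ k ≠ 1` are bounded, and a last
  -- one `N` exists if there is any.
  have hev : ∀ᶠ k in 𝓝 (⊤ : ℕ∞), ξ k ≠ 0 :=
    ξ.continuous.continuousAt.eventually_ne (by rw [htop]; exact one_ne_zero)
  obtain ⟨l, hl, hlξ⟩ := exists_Ioc_subset_of_mem_nhds hev ⟨0, by simp⟩
  lift l to ℕ using hl.ne
  have hbdd : ∀ k : ℕ, ξ k ≠ 1 → k ≤ l + 1 := fun k hk => by
    by_contra! hlt'
    exact hlξ ⟨by exact_mod_cast Nat.lt_succ_self l, le_top⟩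
      (hzero ((l + 1 : ℕ) : ℕ∞) k (by exact_mod_cast hlt') hk)
  by_cases hex : ∃ k : ℕ, ξ k ≠ 1
  · classical
    obtain ⟨k₀, hk₀⟩ := hex
    let N := Nat.findGreatest (fun k => ξ (k : ℕ∞) ≠ 1) (l + 1)
    have hN : ξ (N : ℕ∞) ≠ 1 := 
      Nat.findGreatest_spec (P := fun k => ξ (k : ℕ∞) ≠ 1) (hbdd k₀ hk₀) hk₀
    have hform : ∀ k, ξ k = if k < N then 0 else if k = N then ξ N else 1 := by
      intro k
      split_ifs with h₁ h₂
      · exact hzero k N h₁ hN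
      · rw [h₂]
      · induction k using ENat.recTopCoe with
        | top => exact htop
        | coe k =>
          by_contra hk
          have h₃ : k ≤ N := Nat.le_findGreatest (hbdd k hk) hk
          rw [Nat.cast_lt] at h₁
          rw [Nat.cast_inj] at h₂
          omega
    -- The tails of $\gamma^N$ from $N$ and $N+1$ are $1$ and $-\beta_N$, so the diagonal relation
    -- becomes $(\xi(N)-1)(\xi(N)-\beta_N)=0$.
    have hsq := hmul N N
    rw [integral_congr_ae (.of_forall hform), integral_step, dualConv_real_Ici,
      dualConv_real_Ici, sum_gammaCoeff_of_le le_rfl, sum_gammaCoeff_succ_self] at hsq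
    push_cast at hsq
    have hβ : ξ N = negRatio a N := by
      have : (ξ N - 1) * (ξ N - negRatio a N) = 0 := by linear_combination -hsq
      exact sub_eq_zero.1 ((mul_eq_zero.1 this).resolve_left (sub_ne_zero.2 hN))
    exact ⟨N + 1, fun k => by rw [charTable_succ_ofReal, hform k, hβ]⟩
  · push Not at hex
    refine ⟨0, fun k => ?_⟩
    rw [charTable_zero, Complex.ofReal_one]
    induction k using ENat.recTopCoe with
    | top => exact htop
    | coe k => exact hex k

end IsSuperincreasing

/-! ### Rows of the matrix: separation of measures and the diagonal identity. -/

theorem charTable_natCast_eq {β : ℕ → ℝ} (k n : ℕ) :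
    charTable β k n = (Set.Iic k).indicator (fun _ => 1 - β k) n +
      (Set.Iic (k + 1)).indicator (fun _ => β k) n := by
  simp only [Set.indicator_apply, Set.mem_Iic]
  rcases lt_trichotomy n (k + 1) with h | rfl | h
  · rw [charTable_of_le (by exact_mod_cast Nat.le_of_lt_succ h), if_pos (by omega),
      if_pos (by omega), sub_add_cancel]
  · rw [charTable_succ_self, if_neg (by omega), if_pos le_rfl, zero_add]
  · rw [charTable_of_lt h, if_neg (by omega), if_neg (by omega), add_zero]

theorem integral_charTable_row {β : ℕ → ℝ} (k : ℕ) (μ : Measure ℕ) [IsProbabilityMeasure μ] :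
    ∫ n, (charTable β k n : ℂ) ∂μ =
      (((1 - β k) * μ.real (Set.Iic k) + β k * μ.real (Set.Iic (k + 1)) : ℝ) : ℂ) := by
  rw [integral_complex_ofReal]
  simp_rw [charTable_natCast_eq]
  rw [integral_add ((integrable_const _).indicator .of_discrete)
    ((integrable_const _).indicator .of_discrete), integral_indicator_const _ .of_discrete,
    integral_indicator_const _ .of_discrete, smul_eq_mul, smul_eq_mul, mul_comm,
    mul_comm (β k)]

/-- Probability measures on `ℤ₊` are determined by their integrals against the rows of
`charTable`. -/
theorem eq_of_integral_charTable_row_eq {β : ℕ → ℝ} (hβ : ∀ k, β k < 0)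
    (hβ' : ∀ k, -1 ≤ β k) (μ ν : Measure ℕ)
    [IsProbabilityMeasure μ] [IsProbabilityMeasure ν]
    (h : ∀ k : ℕ, ∫ n, (charTable β k n : ℂ) ∂μ = ∫ n, (charTable β k n : ℂ) ∂ν) : μ = ν := by
  -- The rows relate consecutive differences of distribution functions:
  -- $d_{k+1}=\frac{1-\beta_k}{-\beta_k}d_k$. As $-1\le\beta_k<0$, the factor is at least $2$, so a
  -- nonzero $d_k$ would grow beyond the bound $|d|\le1$.
  let d : ℕ → ℝ := fun k => μ.real (Set.Iic k) - ν.real (Set.Iic k)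
  have hd : ∀ k, (1 - β k) * d k = -β k * d (k + 1) := fun k => by
    have h₁ := h k
    rw [integral_charTable_row, integral_charTable_row, Complex.ofReal_inj] at h₁
    simp only [d]
    linarith
  have hgrow : ∀ k, 2 * |d k| ≤ |d (k + 1)| := fun k => by
    have h₁ := congrArg abs (hd k)
    rw [abs_mul, abs_mul, abs_of_pos (by linarith [hβ k] : 0 < 1 - β k),
      abs_of_pos (by linarith [hβ k] : 0 < -β k)] at h₁
    have h₂ : 0 ≤ |d k| := abs_nonneg _
    have h₃ : -β k * (2 * |d k|) ≤ -β k * |d (k + 1)| := by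
      rw [← h₁]
      nlinarith [hβ' k]
    exact le_of_mul_le_mul_left h₃ (by linarith [hβ k])
  have hbdd : ∀ k, |d k| ≤ 1 := fun k => by
    have h₁ : μ.real (Set.Iic k) ≤ 1 := measureReal_le_one
    have h₂ : ν.real (Set.Iic k) ≤ 1 := measureReal_le_one
    have h₃ : 0 ≤ μ.real (Set.Iic k) := measureReal_nonneg
    have h₄ : 0 ≤ ν.real (Set.Iic k) := measureReal_nonneg
    exact abs_le.2 ⟨by linarith, by linarith⟩
  have hpow : ∀ r k, 2 ^ r * |d k| ≤ |d (k + r)| := fun r k => by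
    induction r with
    | zero => simp
    | succ r ih => rw [pow_succ', mul_assoc, ← add_assoc]; linarith [hgrow (k + r)]
  have hzero : ∀ k, d k = 0 := fun k => by
    by_contra hne
    obtain ⟨r, hr⟩ := pow_unbounded_of_one_lt (|d k|)⁻¹ (one_lt_two (α := ℝ))
    have h₁ := (hpow r k).trans (hbdd _)
    have h₂ : 1 < 2 ^ r * |d k| := by
      rwa [inv_lt_iff_one_lt_mul₀ (abs_pos.2 hne)] at hr
    linarith
  refine Measure.ext_of_Iic μ ν fun k => ?_
  rw [← measureReal_eq_measureReal_iff]
  exact sub_eq_zero.1 (hzero k)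

section SumCharTable

variable {a : ℕ → ℝ} (ha : IsSuperincreasing a)

theorem sum_mul_charTable_of_le {β : ℕ → ℝ} {k : ℕ∞} {n : ℕ} (h : (n : ℕ∞) ≤ k + 1) :
    ∑ j ∈ Finset.range n, a j * charTable β k j = ∑ j ∈ Finset.range n, a j := by
  refine Finset.sum_congr rfl fun j hj => ?_
  rw [charTable_of_le, mul_one]
  have h₁ : (j : ℕ∞) < k + 1 := lt_of_lt_of_le (by exact_mod_cast Finset.mem_range.1 hj) h
  exact Order.le_of_lt_add_one h₁

include ha in
-- The value $\beta_k$ is chosen so that $A_{k+1}+a_{k+1}\beta_k=0$, and later entries vanish.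
theorem IsSuperincreasing.sum_mul_charTable_of_lt {k n : ℕ} (h : k + 1 < n) :
    ∑ j ∈ Finset.range n, a j * charTable (negRatio a) k j = 0 := by
  obtain ⟨r, rfl⟩ := Nat.exists_eq_add_of_le (Nat.succ_le_of_lt h)
  induction r with
  | zero =>
    rw [add_zero, Finset.sum_range_succ, sum_mul_charTable_of_le (by simp),
      charTable_succ_self, ha.negRatio_mul, add_neg_cancel]
  | succ r ih =>
    rw [← add_assoc, Finset.sum_range_succ, ih (by omega), charTable_of_lt (by omega), mul_zero,
      add_zero]

include ha in
-- This is the diagonal relation for row `k` multiplied by $\lambda(n)$: the weights $a_j$ and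
-- $a_n-A_n$ stand for $\lambda(n)q_n(j)$ and $\lambda(n)q_n(n)$. At $n=k+1$ it says that $\beta_k$
-- is a root of $(x-1)(a_nx+A_n)$.
theorem IsSuperincreasing.charTable_sq (k : ℕ∞) (n : ℕ) :
    ∑ j ∈ Finset.range n, a j * charTable (negRatio a) k j +
        (a n - ∑ j ∈ Finset.range n, a j) * charTable (negRatio a) k n =
      a n * (charTable (negRatio a) k n * charTable (negRatio a) k n) := by
  by_cases h₁ : (n : ℕ∞) ≤ k
  · rw [sum_mul_charTable_of_le (h₁.trans le_self_add), charTable_of_le h₁]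
    ring
  · lift k to ℕ using (fun hk => h₁ (hk ▸ le_top))
    rw [Nat.cast_le, not_le] at h₁
    rcases (Nat.succ_le_of_lt h₁).eq_or_lt with rfl | h₂
    · rw [sum_mul_charTable_of_le (by simp), Nat.succ_eq_add_one, charTable_succ_self]
      linear_combination (negRatio a k - 1) * -ha.negRatio_mul k
    · rw [ha.sum_mul_charTable_of_lt h₂, charTable_of_lt h₂]
      ring

end SumCharTable

/-! ### The hypergroup $S$: Haar weights and characters. -/

section MaxDeformation

variable {S : Type*} [LinearOrder S] [OrderBot S] [MeasurableSpace S] {q : S → PMF S}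

theorem maxDeformation_conv_of_ne {m n : S} (h : m ≠ n ∨ n = ⊥) :
    ((maxDeformation q).conv m n : Measure S) = Measure.dirac (max m n) := by
  change (if m = n ∧ n ≠ ⊥ then q n else PMF.pure (max m n)).toMeasure = _
  rw [if_neg (by rcases h with h | h <;> simp [h]), PMF.toMeasure_pure]

theorem maxDeformation_conv_self {n : S} (h : n ≠ ⊥) :
    ((maxDeformation q).conv n n : Measure S) = (q n).toMeasure := by
  change (if n = n ∧ n ≠ ⊥ then q n else PMF.pure (max n n)).toMeasure = _
  rw [if_pos ⟨rfl, h⟩]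

theorem maxDeformation_conv_comm (m n : S) :
    ((maxDeformation q).conv m n : Measure S) = (maxDeformation q).conv n m := by
  by_cases h : m = n
  · rw [h]
  · rw [maxDeformation_conv_of_ne (.inl h), maxDeformation_conv_of_ne (.inl (Ne.symm h)),
      max_comm]

variable (φ : ℕ ≃o S) (hq : IsAdmissible q)

omit [MeasurableSpace S] in
theorem OrderIso.apply_ne_bot {n : ℕ} (h : n ≠ 0) : φ n ≠ ⊥ := by
  rw [← φ.map_bot]
  exact φ.injective.ne h

variable [DiscreteMeasurableSpace S]

include hq

theorem IsAdmissible.toMeasure_eq_sum {n : ℕ} (hn : n ≠ 0) :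
    (q (φ n)).toMeasure =
      ∑ j ∈ Finset.range (n + 1), q (φ n) (φ j) • Measure.dirac (φ j) := by
  have : Countable S := φ.symm.injective.countable
  refine Measure.ext_of_singleton fun s => ?_
  obtain ⟨i, rfl⟩ := φ.surjective s
  rw [PMF.toMeasure_apply_singleton _ _ .of_discrete, Measure.finsetSum_apply]
  simp only [Measure.smul_apply, Measure.dirac_apply, Set.indicator_apply,
    Set.mem_singleton_iff, φ.injective.eq_iff, Pi.one_apply, smul_eq_mul, mul_ite, mul_one,
    mul_zero]
  rw [Finset.sum_ite_eq' (Finset.range (n + 1)) i]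
  split_ifs with h
  · rfl
  · by_contra hne
    have := hq.subset_lower _ (OrderIso.apply_ne_bot φ hn) ((PMF.mem_support_iff _ _).2 hne)
    rw [Set.mem_Iic, φ.le_iff_le] at this
    exact h (Finset.mem_range.2 (by omega))

theorem IsAdmissible.integral_toMeasure {n : ℕ} (hn : n ≠ 0) (f : S → ℂ) :
    ∫ s, f s ∂(q (φ n)).toMeasure =
      ∑ j ∈ Finset.range (n + 1), ((q (φ n) (φ j)).toReal : ℂ) * f (φ j) := by
  rw [hq.toMeasure_eq_sum φ hn, integral_finsetSum_measure]
  · refine Finset.sum_congr rfl fun j _ => ?_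
    rw [integral_smul_measure, integral_dirac, Complex.real_smul]
  · intro j _
    exact (integrable_dirac enorm_lt_top).smul_measure ((q (φ n)).apply_ne_top _)

theorem IsAdmissible.sum_toReal {n : ℕ} (hn : n ≠ 0) :
    ∑ j ∈ Finset.range (n + 1), (q (φ n) (φ j)).toReal = 1 := by
  have h := hq.integral_toMeasure φ hn (fun _ => 1)
  rw [integral_const, probReal_univ, one_smul] at h
  simp only [mul_one] at h
  exact_mod_cast h.symm

omit hq in
theorem haarWeight_maxDeformation_zero : haarWeight (maxDeformation q) (φ 0) = 1 := by
  have h₀ : φ 0 = ⊥ := φ.map_bot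
  rw [haarWeight, h₀]
  change (((maxDeformation q).conv ⊥ ⊥ : Measure S) {⊥}).toReal⁻¹ = 1
  rw [maxDeformation_conv_of_ne (.inr rfl)]
  simp

omit hq in
theorem haarWeight_maxDeformation {n : ℕ} (hn : n ≠ 0) :
    haarWeight (maxDeformation q) (φ n) = (q (φ n) ⊥).toReal⁻¹ := by
  rw [haarWeight]
  change (((maxDeformation q).conv (φ n) (φ n) : Measure S) {⊥}).toReal⁻¹ = _
  rw [maxDeformation_conv_self (OrderIso.apply_ne_bot φ hn),
    PMF.toMeasure_apply_singleton _ _ .of_discrete]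

omit [MeasurableSpace S] [DiscreteMeasurableSpace S] in
theorem IsAdmissible.toReal_bot_pos {n : ℕ} (hn : n ≠ 0) : 0 < (q (φ n) ⊥).toReal := by
  have h := OrderIso.apply_ne_bot φ hn
  exact ENNReal.toReal_pos
    ((PMF.mem_support_iff _ _).1 (hq.lower_subset _ h (bot_lt_iff_ne_bot.2 h)))
    ((q (φ n)).apply_ne_top _)

/-- With $\lambda(n)=1/q_n(0)$ this is the equation $q_n(0)=q_n(j)q_j(0)$ rewritten. It lets
$\lambda$ replace $q$ from here on. -/
theorem IsAdmissible.toReal_mul_haarWeight {j n : ℕ} (h : j < n) :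
    (q (φ n) (φ j)).toReal * haarWeight (maxDeformation q) (φ n) =
      haarWeight (maxDeformation q) (φ j) := by
  have hn : n ≠ 0 := by omega
  have hpos := (hq.toReal_bot_pos φ hn).ne'
  rw [haarWeight_maxDeformation φ hn]
  rcases eq_or_ne j 0 with rfl | hj
  · have h₀ : φ 0 = ⊥ := φ.map_bot
    rw [haarWeight_maxDeformation_zero, h₀, mul_inv_cancel₀ hpos]
  · have h₁ := congrArg ENNReal.toReal
      (hq.apply_bot (φ j) (φ n) (OrderIso.apply_ne_bot φ hj) (φ.lt_iff_lt.2 h))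
    rw [ENNReal.toReal_mul] at h₁
    have hpos' := (hq.toReal_bot_pos φ hj).ne'
    rw [haarWeight_maxDeformation φ hj, h₁]
    rw [h₁] at hpos
    have hpos'' := left_ne_zero_of_mul hpos
    field_simp

theorem IsAdmissible.haarWeight_pos (n : ℕ) : 0 < haarWeight (maxDeformation q) (φ n) := by
  rcases eq_or_ne n 0 with rfl | hn
  · rw [haarWeight_maxDeformation_zero]; exact one_pos
  · rw [haarWeight_maxDeformation φ hn]
    exact inv_pos.2 (hq.toReal_bot_pos φ hn)

theorem IsAdmissible.sum_haarWeight (n : ℕ) :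
    ∑ j ∈ Finset.range n, haarWeight (maxDeformation q) (φ j) =
      (∑ j ∈ Finset.range n, (q (φ n) (φ j)).toReal) * haarWeight (maxDeformation q) (φ n) := by
  rw [Finset.sum_mul]
  exact Finset.sum_congr rfl fun j hj =>
    (hq.toReal_mul_haarWeight φ (Finset.mem_range.1 hj)).symm

/-- Summing the previous relation gives $\lambda(\mathcal L_n)=q_n(\mathcal L_n)\lambda(n)$, and
$q_n(\mathcal L_n)\le1$. -/
theorem IsAdmissible.isSuperincreasing :
    IsSuperincreasing fun n => haarWeight (maxDeformation q) (φ n) where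
  pos := hq.haarWeight_pos φ
  sum_le n := by
    rcases eq_or_ne n 0 with rfl | hn
    · simpa using (hq.haarWeight_pos φ 0).le
    · rw [hq.sum_haarWeight φ n]
      refine mul_le_of_le_one_left (hq.haarWeight_pos φ n).le ?_
      rw [← hq.sum_toReal φ hn, Finset.sum_range_succ]
      exact le_add_of_nonneg_right ENNReal.toReal_nonneg

theorem IsAdmissible.haarWeight_mul_integral {n : ℕ} (hn : n ≠ 0) (f : S → ℂ) :
    (haarWeight (maxDeformation q) (φ n) : ℂ) *
        ∫ s, f s ∂((maxDeformation q).conv (φ n) (φ n) : Measure S) =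
      ∑ j ∈ Finset.range n, (haarWeight (maxDeformation q) (φ j) : ℂ) * f (φ j) +
        ((haarWeight (maxDeformation q) (φ n) : ℂ) -
          ∑ j ∈ Finset.range n, (haarWeight (maxDeformation q) (φ j) : ℂ)) * f (φ n) := by
  have h₁ : ((haarWeight (maxDeformation q) (φ n) : ℂ) -
      ∑ j ∈ Finset.range n, (haarWeight (maxDeformation q) (φ j) : ℂ)) =
      haarWeight (maxDeformation q) (φ n) * (q (φ n) (φ n)).toReal := by
    have h₂ := hq.sum_toReal φ hn
    rw [Finset.sum_range_succ] at h₂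
    have h₃ := hq.sum_haarWeight φ n
    rw [← Complex.ofReal_sum, h₃, ← Complex.ofReal_sub, ← Complex.ofReal_mul]
    congr 1
    linear_combination -haarWeight (maxDeformation q) (φ n) * h₂
  rw [maxDeformation_conv_self (OrderIso.apply_ne_bot φ hn), hq.integral_toMeasure φ hn, h₁,
    Finset.sum_range_succ, mul_add, Finset.mul_sum, mul_assoc]
  congr 1
  refine Finset.sum_congr rfl fun j hj => ?_
  rw [← hq.toReal_mul_haarWeight φ (Finset.mem_range.1 hj)]
  push_cast
  ring

theorem IsAdmissible.integral_charTable_conv (k : ℕ∞) (x y : S) :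
    ∫ s, (charTable (betaCoeff q φ) k (φ.symm s) : ℂ)
        ∂((maxDeformation q).conv x y : Measure S) =
      charTable (betaCoeff q φ) k (φ.symm x) * charTable (betaCoeff q φ) k (φ.symm y) := by
  by_cases h : x ≠ y ∨ y = ⊥
  · rw [maxDeformation_conv_of_ne h, integral_dirac, ← Complex.ofReal_mul]
    congr 1
    rcases lt_trichotomy x y with hlt | rfl | hlt
    · rw [max_eq_right hlt.le, charTable_mul_of_lt (φ.symm.lt_iff_lt.2 hlt)]
    · obtain rfl : x = ⊥ := by simpa using h
      rw [max_self, φ.symm.map_bot]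
      simp [charTable_zero]
    · rw [max_eq_left hlt.le, mul_comm, charTable_mul_of_lt (φ.symm.lt_iff_lt.2 hlt)]
  · push Not at h
    obtain ⟨rfl, hx⟩ := h
    obtain ⟨n, rfl⟩ := φ.surjective x
    have hn : n ≠ 0 := by
      rintro rfl
      exact hx φ.map_bot
    have hne : (haarWeight (maxDeformation q) (φ n) : ℂ) ≠ 0 :=
      Complex.ofReal_ne_zero.2 (hq.haarWeight_pos φ n).ne'
    refine mul_left_cancel₀ hne ?_
    rw [hq.haarWeight_mul_integral φ hn]
    simp only [φ.symm_apply_apply]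
    exact_mod_cast (hq.isSuperincreasing φ).charTable_sq k n

/-- The characters of `maxDeformation q` are the rows of `charTable`. -/
theorem IsAdmissible.exists_eq_charTable_row (χ : S → ℂ) (h₀ : χ ≠ 0)
    (hmul : ∀ x y, ∫ s, χ s ∂((maxDeformation q).conv x y : Measure S) = χ x * χ y) :
    ∃ k : ℕ∞, ∀ n, χ (φ n) = charTable (betaCoeff q φ) k n := by
  have hlt : ∀ m n : ℕ, m < n → χ (φ n) = χ (φ m) * χ (φ n) := fun m n h => by
    have h' : φ m < φ n := φ.lt_iff_lt.2 h
    rw [← hmul, maxDeformation_conv_of_ne (.inl h'.ne), integral_dirac, max_eq_right h'.le]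
  have hbot : χ (φ 0) = 1 := by
    by_contra hne
    have hb : χ (φ 0) = 0 := by
      have h := hmul (φ 0) (φ 0)
      rw [maxDeformation_conv_of_ne (.inr (show φ 0 = ⊥ from φ.map_bot)),
        integral_dirac, max_self] at h
      by_contra h'
      exact hne (mul_left_cancel₀ h' (by rw [← h, mul_one]))
    refine h₀ (funext fun s => ?_)
    obtain ⟨n, rfl⟩ := φ.surjective s
    rcases Nat.eq_zero_or_pos n with rfl | hn
    · exact hb
    · rw [hlt 0 n hn, hb, zero_mul]; rfl
  have hzero : ∀ m n : ℕ, m < n → χ (φ m) ≠ 1 → χ (φ n) = 0 := fun m n h hm => by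
    by_contra hn
    exact hm (mul_right_cancel₀ hn (by rw [← hlt m n h, one_mul]))
  by_cases hex : ∃ n : ℕ, χ (φ n) ≠ 1
  · classical
    -- The first index with value other than $1$ is a successor because `χ (φ 0) = 1`; all later
    -- values vanish by `hzero`.
    obtain ⟨k, hk⟩ : ∃ k, Nat.find hex = k + 1 := Nat.exists_eq_succ_of_ne_zero fun h => by
      have := Nat.find_spec hex
      rw [h] at this
      exact this hbot
    have hspec : χ (φ (k + 1)) ≠ 1 := hk ▸ Nat.find_spec hex
    have hmin : ∀ n, n ≤ k → χ (φ n) = 1 := fun n hn => by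
      have := Nat.find_min hex (m := n) (by omega)
      push Not at this
      exact this
    refine ⟨k, fun n => ?_⟩
    rcases lt_trichotomy n (k + 1) with h | rfl | h
    · rw [charTable_of_le (by exact_mod_cast Nat.le_of_lt_succ h), Complex.ofReal_one]
      exact hmin n (by omega)
    · rw [charTable_succ_self]
      have h₁ := hq.haarWeight_mul_integral φ (Nat.succ_ne_zero k) χ
      rw [hmul, Finset.sum_congr rfl (fun j hj => by
        rw [hmin j (Nat.le_of_lt_succ (Finset.mem_range.1 hj)), mul_one])] at h₁
      have h₂ := congrArg (fun r : ℝ => (r : ℂ)) ((hq.isSuperincreasing φ).negRatio_mul k)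
      push_cast at h₂
      have hne : (haarWeight (maxDeformation q) (φ (k + 1)) : ℂ) ≠ 0 :=
        Complex.ofReal_ne_zero.2 (hq.haarWeight_pos φ (k + 1)).ne'
      -- All earlier values are $1$, so the diagonal relation reads $a x^2=A+(a-A)x$ with
      -- $a=a_{k+1}$, $A=A_{k+1}=-a\beta_k$.
      have hprod : (haarWeight (maxDeformation q) (φ (k + 1)) : ℂ) *
          ((χ (φ (k + 1)) - 1) * (χ (φ (k + 1)) - (betaCoeff q φ k : ℂ))) = 0 := by
        change _ * (_ * (_ - (negRatio _ k : ℂ))) = _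
        rw [Nat.succ_eq_add_one] at h₁
        linear_combination h₁ - (χ (φ (k + 1)) - 1) * h₂
      rcases mul_eq_zero.1 ((mul_eq_zero.1 hprod).resolve_left hne) with h | h
      · exact absurd (sub_eq_zero.1 h) hspec
      · exact sub_eq_zero.1 h
    · rw [charTable_of_lt h, Complex.ofReal_zero]
      exact hzero (k + 1) n h hspec
  · push Not at hex
    exact ⟨⊤, fun n => by rw [hex, charTable_top, Complex.ofReal_one]⟩

theorem IsAdmissible.eq_of_integral_charTable_eq (μ ν : Measure S)
    [IsProbabilityMeasure μ] [IsProbabilityMeasure ν]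
    (h : ∀ k : ℕ, ∫ s, (charTable (betaCoeff q φ) k (φ.symm s) : ℂ) ∂μ =
      ∫ s, (charTable (betaCoeff q φ) k (φ.symm s) : ℂ) ∂ν) : μ = ν := by
  let e : S ≃ᵐ ℕ := ⟨φ.symm.toEquiv, Measurable.of_discrete, Measurable.of_discrete⟩
  have ha := hq.isSuperincreasing φ
  have h₁ : IsProbabilityMeasure (μ.map e) :=
    Measure.isProbabilityMeasure_map e.measurable.aemeasurable
  have h₂ : IsProbabilityMeasure (ν.map e) :=
    Measure.isProbabilityMeasure_map e.measurable.aemeasurable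
  refine e.map_measurableEquiv_injective
    (eq_of_integral_charTable_row_eq (β := betaCoeff q φ) ha.negRatio_neg
      ha.neg_one_le_negRatio (μ.map e) (ν.map e) fun k => ?_)
  rw [integral_map_equiv, integral_map_equiv]
  exact h k

end MaxDeformation

theorem IsAdmissible.isHypergroup_maxDeformation {S : Type*} [LinearOrder S] [OrderBot S]
    [TopologicalSpace S] [DiscreteTopology S] [MeasurableSpace S] [BorelSpace S]
    (φ : ℕ ≃o S) {q : S → PMF S} (hq : IsAdmissible q) :
    IsHypergroup (maxDeformation q) := by
  have : Countable S := φ.symm.injective.countable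
  exact
  { t2 := inferInstance
    locallyCompact := inferInstance
    regular := fun x y => inferInstance
    isCompact_support := fun x y => by
      have hfin : (Set.Iic (max x y)).Finite := by
        rw [← φ.symm.symm_apply_apply (max x y)]
        exact ((Set.finite_Iic (φ.symm (max x y))).image φ).subset fun s hs =>
          ⟨φ.symm s, φ.symm.le_iff_le.2 (by simpa using hs), φ.apply_symm_apply s⟩
      refine (hfin.subset ?_).isCompact
      refine Measure.support_subset_of_isClosed (isClosed_discrete _) ?_
      rw [mem_ae_iff]
      by_cases h : x ≠ y ∨ y = ⊥
      · rw [maxDeformation_conv_of_ne h]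
        simp
      · push Not at h
        obtain ⟨rfl, hx⟩ := h
        rw [maxDeformation_conv_self hx, max_self,
          ← prob_compl_eq_one_iff MeasurableSet.of_discrete, compl_compl,
          PMF.toMeasure_apply_eq_one_iff _ MeasurableSet.of_discrete]
        exact hq.subset_lower x hx
    continuous_conv := continuous_of_discreteTopology
    continuous_support := by
      let _ := TopologicalSpace.vietoris S
      exact continuous_of_discreteTopology
    assoc := fun x y z f =>
      ConvolutionData.assoc_of_separating (maxDeformation q)
        (fun (k : ℕ) s => (charTable (betaCoeff q φ) k (φ.symm s) : ℂ))
        (fun k => ⟨1, fun s => by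
          rw [Complex.norm_real]
          exact abs_charTable_le (hq.isSuperincreasing φ).abs_negRatio_le k _⟩)
        (fun k => hq.integral_charTable_conv φ k)
        (fun μ ν _ _ h => hq.eq_of_integral_charTable_eq φ μ ν h) x y z f
        ⟨‖f‖, f.norm_coe_le_norm⟩
    conv_e := fun x => by
      change ((maxDeformation q).conv x ⊥ : Measure S) = _
      rw [maxDeformation_conv_of_ne (.inr rfl), max_eq_left bot_le]
    e_conv := fun x => by
      change ((maxDeformation q).conv ⊥ x : Measure S) = _
      rw [maxDeformation_conv_comm, maxDeformation_conv_of_ne (.inr rfl), max_eq_left bot_le]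
    inv_inv := fun x => rfl
    continuous_inv := continuous_id
    map_inv := fun x y => by
      change ((maxDeformation q).conv x y : Measure S).map id =
        ((maxDeformation q).conv y x : Measure S)
      rw [Measure.map_id, maxDeformation_conv_comm]
    e_mem_support := fun x y => by
      change ⊥ ∈ ((maxDeformation q).conv x y : Measure S).support ↔ x = y
      by_cases h : x ≠ y ∨ y = ⊥
      · rw [maxDeformation_conv_of_ne h, Measure.support_dirac_of_t1, Set.mem_singleton_iff,
          eq_comm, max_eq_bot]
        refine ⟨fun h' => h'.1.trans h'.2.symm, fun h' => ?_⟩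
        have hy := h.resolve_left (not_not.2 h')
        exact ⟨h'.trans hy, hy⟩
      · push Not at h
        obtain ⟨rfl, hx⟩ := h
        refine iff_of_true ((Measure.mem_support_iff_forall _).2 fun U hU => ?_) rfl
        rw [maxDeformation_conv_self hx]
        refine lt_of_lt_of_le ?_
          (measure_mono (Set.singleton_subset_iff.2 (mem_of_mem_nhds hU)))
        rw [PMF.toMeasure_apply_singleton _ _ .of_discrete, pos_iff_ne_zero]
        exact (PMF.mem_support_iff _ _).1
          (hq.lower_subset x hx (bot_lt_iff_ne_bot.2 hx)) }

instance DiscreteTopology.discreteMeasurableSpace {X : Type*} [TopologicalSpace X]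
    [DiscreteTopology X] [MeasurableSpace X] [BorelSpace X] : DiscreteMeasurableSpace X :=
  ⟨fun s => (isOpen_discrete s).measurableSet⟩

/-! ### The dual and the second dual of $S$. -/

section DualOfMaxDeformation

namespace SymmDual

variable {K : Type*} [TopologicalSpace K] [MeasurableSpace K] {H : ConvolutionData K}

instance : T2Space (SymmDual H) :=
  inferInstanceAs (T2Space {χ : C(K, ℂ) // IsSymmCharacter H χ})

theorem ext {χ ψ : SymmDual H} (h : ∀ x, χ x = ψ x) : χ = ψ :=
  Subtype.ext (ContinuousMap.ext h)

theorem continuous_apply (x : K) : Continuous fun χ : SymmDual H => χ x :=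
  (continuous_eval_const x).comp continuous_subtype_val

end SymmDual

open Filter Topology in
theorem continuous_charTable_left (β : ℕ → ℝ) (n : ℕ) :
    Continuous fun k : ℕ∞ => charTable β k n := by
  refine continuous_iff_continuousAt.2 fun k => ?_
  induction k using ENat.recTopCoe with
  | top =>
    refine tendsto_nhds_of_eventually_eq ?_
    filter_upwards [lt_mem_nhds (ENat.natCast_lt_top n)] with k hk
    rw [charTable_of_le hk.le, charTable_top]
  | coe k => simp [ContinuousAt, tendsto_pure_nhds]

variable {S : Type*} [LinearOrder S] [OrderBot S]
  [TopologicalSpace S] [DiscreteTopology S] [MeasurableSpace S] [BorelSpace S]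
  (φ : ℕ ≃o S) {q : S → PMF S} (hq : IsAdmissible q)

namespace IsAdmissible

/-- The `k`-th row of `charTable`, as a character. -/
def rowCharacter (k : ℕ∞) : SymmDual (maxDeformation q) :=
  ⟨⟨fun s => (charTable (betaCoeff q φ) k (φ.symm s) : ℂ), continuous_of_discreteTopology⟩,
    ⟨⟨1, fun s => by
        rw [ContinuousMap.coe_mk, Complex.norm_real]
        exact abs_charTable_le (hq.isSuperincreasing φ).abs_negRatio_le k _⟩,
      fun h => by
        have h₁ := DFunLike.congr_fun h (φ 0)
        rw [ContinuousMap.coe_mk, φ.symm_apply_apply, charTable_zero] at h₁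
        exact one_ne_zero (Complex.ofReal_eq_zero.1 h₁),
      hq.integral_charTable_conv φ k⟩,
    fun _ => (Complex.conj_ofReal _).symm⟩

theorem rowCharacter_apply (k : ℕ∞) (s : S) :
    hq.rowCharacter φ k s = charTable (betaCoeff q φ) k (φ.symm s) := rfl

include hq in
theorem charTable_le_zero {k n : ℕ} (h : k < n) : charTable (betaCoeff q φ) k n ≤ 0 := by
  rcases (Nat.succ_le_of_lt h).eq_or_lt with rfl | h'
  · rw [Nat.succ_eq_add_one, charTable_succ_self]
    exact ((hq.isSuperincreasing φ).negRatio_neg k).le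
  · rw [charTable_of_lt h']

/-- For $k<l$ the rows differ at $k+1$: row `k` is negative there, row `l` is $1$. -/
theorem rowCharacter_injective : Function.Injective (hq.rowCharacter φ) := by
  have key : ∀ k l : ℕ∞, k < l → hq.rowCharacter φ k ≠ hq.rowCharacter φ l := by
    intro k l hkl h
    lift k to ℕ using hkl.ne_top
    have h₁ : hq.rowCharacter φ k (φ (k + 1)) = hq.rowCharacter φ l (φ (k + 1)) := by rw [h]
    rw [rowCharacter_apply, rowCharacter_apply, φ.symm_apply_apply, Complex.ofReal_inj,
      charTable_of_le (k := l) (by push_cast; exact Order.add_one_le_of_lt hkl)] at h₁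
    have := hq.charTable_le_zero φ (Nat.lt_succ_self k)
    rw [Nat.succ_eq_add_one, h₁] at this
    exact absurd this (by norm_num)
  intro k l h
  rcases lt_trichotomy k l with hlt | heq | hlt
  · exact absurd h (key k l hlt)
  · exact heq
  · exact absurd h.symm (key l k hlt)

theorem rowCharacter_surjective : Function.Surjective (hq.rowCharacter φ) := by
  intro χ
  obtain ⟨k, hk⟩ := hq.exists_eq_charTable_row φ (fun s => χ s)
    (fun h => χ.2.1.2.1 (ContinuousMap.ext fun s => congrFun h s)) χ.2.1.2.2
  refine ⟨k, SymmDual.ext fun s => ?_⟩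
  rw [rowCharacter_apply, ← hk, φ.apply_symm_apply]

theorem continuous_rowCharacter : Continuous (hq.rowCharacter φ) := by
  refine Continuous.subtype_mk (ContinuousMap.continuous_of_continuous_uncurry _ ?_) _
  exact continuous_prod_of_discrete_right.2 fun s =>
    Complex.continuous_ofReal.comp (continuous_charTable_left (betaCoeff q φ) (φ.symm s))

/-- The dual of `maxDeformation q` is homeomorphic to `ℤ₊ ∪ {∞}`. -/
def dualHomeo : ℕ∞ ≃ₜ SymmDual (maxDeformation q) :=
  Continuous.homeoOfEquivCompactToT2
    (f := Equiv.ofBijective (hq.rowCharacter φ)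
      ⟨hq.rowCharacter_injective φ, hq.rowCharacter_surjective φ⟩)
    (hq.continuous_rowCharacter φ)

theorem dualHomeo_apply (k : ℕ∞) (s : S) :
    hq.dualHomeo φ k s = charTable (betaCoeff q φ) k (φ.symm s) := rfl

/-- The convolution on the dual of `maxDeformation q`. -/
def dual : ConvolutionData (SymmDual (maxDeformation q)) :=
  (hq.isSuperincreasing φ).dualConv.transport (hq.dualHomeo φ)

theorem isHypergroup_dual : IsHypergroup (hq.dual φ) :=
  (hq.isSuperincreasing φ).isHypergroup_dualConv.transport _

theorem isHermitian_dual : IsHermitian (hq.dual φ) :=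
  IsHermitian.transport (fun _ => rfl) _

theorem isPointwiseMul_dual : IsPointwiseMul (hq.dual φ) where
  integral_conv χ ψ s := by
    obtain ⟨k, rfl⟩ := (hq.dualHomeo φ).surjective χ
    obtain ⟨l, rfl⟩ := (hq.dualHomeo φ).surjective ψ
    rw [dual, ConvolutionData.integral_transport, Homeomorph.symm_apply_apply,
      Homeomorph.symm_apply_apply]
    exact (hq.isSuperincreasing φ).integral_charTable_dualConv (φ.symm s) k l
  e_apply s := by
    change hq.dualHomeo φ ⊤ s = 1
    rw [dualHomeo_apply, charTable_top, Complex.ofReal_one]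
  inv_apply χ s := by
    rw [hq.isHermitian_dual φ χ]
    exact χ.2.2 s

theorem dual_conv_of_ne {m n : ℕ∞} (h : m ≠ n ∨ (m = ⊤ ∧ n = ⊤)) :
    ((hq.dual φ).conv (hq.dualHomeo φ m) (hq.dualHomeo φ n) :
      Measure (SymmDual (maxDeformation q))) = Measure.dirac (hq.dualHomeo φ (min m n)) := by
  rw [dual, ConvolutionData.transport_conv, Homeomorph.symm_apply_apply,
    Homeomorph.symm_apply_apply, IsSuperincreasing.dualConv, minDeformation.coe_conv_of_ne h,
    Measure.map_dirac' (hq.dualHomeo φ).continuous.measurable]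

theorem dual_conv_self (m : ℕ) :
    ((hq.dual φ).conv (hq.dualHomeo φ m) (hq.dualHomeo φ m) :
      Measure (SymmDual (maxDeformation q))) = Measure.sum fun j : ℕ =>
        ENNReal.ofReal (gammaCoeff (betaCoeff q φ) m j) •
          Measure.dirac (hq.dualHomeo φ j) := by
  rw [dual, ConvolutionData.transport_conv, Homeomorph.symm_apply_apply,
    IsSuperincreasing.dualConv, minDeformation.conv_self_eq_sum,
    Measure.map_sum (hq.dualHomeo φ).continuous.measurable.aemeasurable]
  congr 1
  ext1 j
  rw [Measure.map_smul, Measure.map_dirac' (hq.dualHomeo φ).continuous.measurable]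
  rfl

theorem exists_eq_eval {ξ : C(SymmDual (maxDeformation q), ℂ)}
    (hξ : IsBddCharacter (hq.dual φ) ξ) : ∃ s : S, ∀ τ, ξ τ = τ s := by
  obtain ⟨-, h₀, hmul⟩ := hξ
  obtain ⟨n, hn⟩ := (hq.isSuperincreasing φ).exists_eq_charTable_column
    (ξ.comp ⟨hq.dualHomeo φ, (hq.dualHomeo φ).continuous⟩)
    (fun h => h₀ (ContinuousMap.ext fun τ => by
      obtain ⟨k, rfl⟩ := (hq.dualHomeo φ).surjective τ
      exact DFunLike.congr_fun h k))
    (fun x y => by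
      have h := hmul (hq.dualHomeo φ x) (hq.dualHomeo φ y)
      rw [dual, ConvolutionData.integral_transport, Homeomorph.symm_apply_apply,
        Homeomorph.symm_apply_apply] at h
      exact h)
  refine ⟨φ n, fun τ => ?_⟩
  obtain ⟨k, rfl⟩ := (hq.dualHomeo φ).surjective τ
  rw [dualHomeo_apply, φ.symm_apply_apply]
  exact hn k

/-- A bounded character is evaluation at some point of $S$, and evaluation turns the involution into
conjugation. -/
theorem isBddCharacter_dual_iff (ξ : C(SymmDual (maxDeformation q), ℂ)) :
    IsBddCharacter (hq.dual φ) ξ ↔ IsSymmCharacter (hq.dual φ) ξ := by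
  refine ⟨fun h => ⟨h, fun τ => ?_⟩, fun h => h.1⟩
  obtain ⟨s, hs⟩ := hq.exists_eq_eval φ h
  rw [hs, hs, (hq.isPointwiseMul_dual φ).inv_apply]

/-- Evaluation at `s`, as a character of the dual. -/
def evalCharacter (s : S) : SymmDual (hq.dual φ) :=
  ⟨⟨fun τ => τ s, SymmDual.continuous_apply s⟩,
    (hq.isBddCharacter_dual_iff φ _).1
      ⟨⟨1, fun τ => by
        obtain ⟨k, rfl⟩ := (hq.dualHomeo φ).surjective τ
        rw [ContinuousMap.coe_mk, dualHomeo_apply, Complex.norm_real]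
        exact abs_charTable_le (hq.isSuperincreasing φ).abs_negRatio_le k _⟩,
      fun h => by
        have h₁ := DFunLike.congr_fun h (hq.dualHomeo φ ⊤)
        rw [ContinuousMap.coe_mk, dualHomeo_apply, charTable_top] at h₁
        exact one_ne_zero (Complex.ofReal_eq_zero.1 h₁),
      fun χ ψ => (hq.isPointwiseMul_dual φ).integral_conv χ ψ s⟩⟩

theorem evalCharacter_apply (s : S) (τ : SymmDual (maxDeformation q)) :
    hq.evalCharacter φ s τ = τ s := rfl

theorem evalCharacter_surjective : Function.Surjective (hq.evalCharacter φ) := fun ξ => by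
  obtain ⟨s, hs⟩ := hq.exists_eq_eval φ ξ.2.1
  exact ⟨s, SymmDual.ext fun τ => (hs τ).symm⟩

/-- The sign of $\chi_n(m)$ recovers whether $m\le n$; this gives both injectivity of evaluation and
discreteness of the second dual. -/
theorem le_of_evalCharacter_pos {m n : ℕ}
    (h : 0 < (hq.evalCharacter φ (φ m) (hq.dualHomeo φ n)).re) : m ≤ n := by
  by_contra! hlt
  rw [evalCharacter_apply, dualHomeo_apply, φ.symm_apply_apply, Complex.ofReal_re] at h
  exact absurd h (hq.charTable_le_zero φ hlt).not_gt

theorem evalCharacter_pos (n : ℕ) :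
    0 < (hq.evalCharacter φ (φ n) (hq.dualHomeo φ n)).re := by
  rw [evalCharacter_apply, dualHomeo_apply, φ.symm_apply_apply, Complex.ofReal_re,
    charTable_of_le le_rfl]
  exact one_pos

theorem evalCharacter_injective : Function.Injective (hq.evalCharacter φ) := by
  intro s t h
  obtain ⟨m, rfl⟩ := φ.surjective s
  obtain ⟨n, rfl⟩ := φ.surjective t
  congr 1
  refine le_antisymm (hq.le_of_evalCharacter_pos φ ?_) (hq.le_of_evalCharacter_pos φ ?_)
  · rw [h]; exact hq.evalCharacter_pos φ n
  · rw [← h]; exact hq.evalCharacter_pos φ m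

/-- Positivity of the real part at $\chi_n$ is an open condition that holds for $\xi_n$ and only for
$\xi_m$ with $m\le n$. A point with a finite neighbourhood in a Hausdorff space is isolated. -/
theorem discreteTopology_symmDual_dual : DiscreteTopology (SymmDual (hq.dual φ)) := by
  refine discreteTopology_iff_isOpen_singleton.2 fun ξ => ?_
  obtain ⟨s, rfl⟩ := hq.evalCharacter_surjective φ ξ
  obtain ⟨n, rfl⟩ := φ.surjective s
  refine isOpen_singleton_of_finite_mem_nhds _
    (s := {ζ | 0 < (ζ (hq.dualHomeo φ n)).re}) ?_ ?_
  · exact (isOpen_lt continuous_const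
      (Complex.continuous_re.comp (SymmDual.continuous_apply _))).mem_nhds
      (hq.evalCharacter_pos φ n)
  · refine ((Set.finite_Iic n).image fun m => hq.evalCharacter φ (φ m)).subset fun ζ hζ => ?_
    obtain ⟨t, rfl⟩ := hq.evalCharacter_surjective φ ζ
    obtain ⟨m, rfl⟩ := φ.surjective t
    exact ⟨m, hq.le_of_evalCharacter_pos φ hζ, rfl⟩

/-- Evaluation identifies `S` with its second dual. -/
def evalHomeo : S ≃ₜ SymmDual (hq.dual φ) :=
  have := hq.discreteTopology_symmDual_dual φ
  { Equiv.ofBijective (hq.evalCharacter φ)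
      ⟨hq.evalCharacter_injective φ, hq.evalCharacter_surjective φ⟩ with
    continuous_toFun := continuous_of_discreteTopology
    continuous_invFun := continuous_of_discreteTopology }

theorem evalHomeo_apply (s : S) (τ : SymmDual (maxDeformation q)) :
    hq.evalHomeo φ s τ = τ s := rfl

/-- The integral formula at `τ` is the multiplicativity of `τ` on $S$ itself. -/
theorem isPointwiseMul_bidual :
    IsPointwiseMul ((maxDeformation q).transport (hq.evalHomeo φ)) where
  integral_conv ξ ζ τ := by
    obtain ⟨s, rfl⟩ := (hq.evalHomeo φ).surjective ξ
    obtain ⟨t, rfl⟩ := (hq.evalHomeo φ).surjective ζ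
    rw [ConvolutionData.integral_transport, Homeomorph.symm_apply_apply,
      Homeomorph.symm_apply_apply]
    exact τ.2.1.2.2 s t
  e_apply τ := by
    change τ ⊥ = 1
    obtain ⟨k, rfl⟩ := (hq.dualHomeo φ).surjective τ
    rw [dualHomeo_apply, φ.symm.map_bot]
    exact congrArg Complex.ofReal (charTable_zero k)
  inv_apply ξ τ := by
    rw [IsHermitian.transport (fun _ => rfl) (hq.evalHomeo φ) ξ]
    have h := ξ.2.2 τ
    rwa [hq.isHermitian_dual φ τ] at h

end IsAdmissible

end DualOfMaxDeformation

end

theorem theorem3p8 {S : Type*} [LinearOrder S] [OrderBot S]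
    [TopologicalSpace S] [DiscreteTopology S] [MeasurableSpace S] [BorelSpace S]
    (φ : ℕ ≃o S) (q : S → PMF S) (hq : IsAdmissible q) :
    -- `(S, *)` is a hermitian discrete hypergroup
    (IsHypergroup (maxDeformation q) ∧ IsHermitian (maxDeformation q)) ∧
    -- its dual is a countable compact space
    Countable (SymmDual (maxDeformation q)) ∧ CompactSpace (SymmDual (maxDeformation q)) ∧
    -- its members are the characters `χ k`
    ∃ χ : ℕ∞ ≃ₜ SymmDual (maxDeformation q),
      (∀ (k : ℕ∞) (n : ℕ), χ k (φ n) = (charTable (betaCoeff q φ) k n : ℂ)) ∧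
      -- the dual is a hermitian hypergroup under pointwise multiplication
      ∃ D : ConvolutionData (SymmDual (maxDeformation q)),
        IsHypergroup D ∧ IsHermitian D ∧ IsPointwiseMul D ∧
        -- the convolution of the dual
        (∀ m n : ℕ∞, m ≠ n ∨ (m = ⊤ ∧ n = ⊤) →
          (D.conv (χ m) (χ n) : Measure (SymmDual (maxDeformation q))) =
            Measure.dirac (χ (min m n))) ∧
        (∀ m : ℕ,
          (D.conv (χ m) (χ m) : Measure (SymmDual (maxDeformation q))) =
            Measure.sum fun j : ℕ =>
              ENNReal.ofReal (gammaCoeff (betaCoeff q φ) m j) • Measure.dirac (χ j)) ∧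
        (∀ m : ℕ, 0 ≤ gammaCoeff (betaCoeff q φ) m m) ∧
        (∀ m p : ℕ, 1 ≤ p → 0 < gammaCoeff (betaCoeff q φ) m (m + p)) ∧
        -- all bounded characters of the dual are symmetric
        (∀ ξ : C(SymmDual (maxDeformation q), ℂ), IsBddCharacter D ξ ↔ IsSymmCharacter D ξ) ∧
        -- the second dual is a hypergroup, isomorphic to `(S, *)` by evaluation
        ∃ D₂ : ConvolutionData (SymmDual D),
          IsHypergroup D₂ ∧ IsHermitian D₂ ∧ IsPointwiseMul D₂ ∧
          ∃ ξ : S ≃ₜ SymmDual D,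
            (∀ (n : S) (τ : SymmDual (maxDeformation q)), ξ n τ = τ n) ∧
            IsHypergroupIso (maxDeformation q) D₂ ξ := by
  have : Countable S := φ.symm.injective.countable
  have ha := hq.isSuperincreasing φ
  refine ⟨⟨hq.isHypergroup_maxDeformation φ, fun _ => rfl⟩,
    (hq.dualHomeo φ).symm.injective.countable, (hq.dualHomeo φ).compactSpace,
    hq.dualHomeo φ, fun k n => ?_, hq.dual φ, hq.isHypergroup_dual φ, hq.isHermitian_dual φ,
    hq.isPointwiseMul_dual φ, fun m n h => hq.dual_conv_of_ne φ h, hq.dual_conv_self φ,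
    ha.gammaCoeff_self_nonneg, fun m p hp => ha.gammaCoeff_pos (by omega),
    hq.isBddCharacter_dual_iff φ, (maxDeformation q).transport (hq.evalHomeo φ),
    (hq.isHypergroup_maxDeformation φ).transport _, IsHermitian.transport (fun _ => rfl) _,
    hq.isPointwiseMul_bidual φ, hq.evalHomeo φ, hq.evalHomeo_apply φ,
    (maxDeformation q).isHypergroupIso_transport _⟩
  rw [hq.dualHomeo_apply, φ.symm_apply_apply]
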